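/- Let $\ell_1,\dots,\ell_d>0$ and let $\mathcal X=\prod_{j=1}^d \mathbb R/\ell_j\mathbb Z$ be the $d$-dimensional flat torus (a box with periodic boundary condition), with Lebesgue measure $dx$. Let $\mathcal H$ be a reproducing kernel Hilbert space of real functions on $\mathcal X$ with kernel $K$, $K_x=K(x,\cdot)$, let $\mathcal I:\mathcal H\to L^2(\mathcal X,dx)$ be the embedding, and let $(\mu_i,\psi_i)$ be the positive eigenvalues (with multiplicity) and $L^2$-orthonormal eigenfunctions of the integral operator $\mathcal T=\mathcal I\mathcal I^*$, $\mathcal T h(x)=\int K(x,x')h(x')\,dx'$. For $\beta\ge 0$ let $\mathcal H^\beta=\{\sum_i u_i\mu_i^{\beta/2}\psi_i:\sum_i u_i^2<\infty\}$ with $\|f\|_{\mathcal H^\beta}^2=\sum_i\mu_i^{-\beta}\langle f,\psi_i\rangle_{L^2}^2$. Let $\mathbb P$ be a Borel probability measure on $\mathcal X$, $F^*:\mathcal H\to\mathbb R$, and let $f^*\neq 0$ be a minimizer over $\mathcal H$ of $L(f)=-\mathbb E_{X\sim\mathbb P}[f(X)]+F^*(f)$. For $X_1,\dots,X_n$ i.i.d.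 from $\mathbb P$ and $\lambda>0$ let $$f_{n,\lambda}=\operatorname*{argmin}_{f\in\mathcal H}\Bigl\{-\frac1n\sum_{i=1}^n f(X_i)+F^*(f)+\frac{\lambda}{2}\|f\|_{\mathcal H}^2\Bigr\}.$$ Write $\mathcal DF^*,\mathcal D^2F^*,\mathcal D^3F^*$ for the Fréchet derivatives of $F^*$ in the norm of $\mathcal H$ (identified with elements of $\mathcal H$, operators on $\mathcal H$, and bilinear maps into $\mathcal H$). Assume: 1. $F^*$ is three times Fréchet differentiable and, for some $\kappa>0$, $F^*(f)-F^*(f')-\langle \mathcal DF^*(f'),f-f'\rangle_{\mathcal H}\ge\frac{\kappa}{2}\int_{\mathcal X}|f(x)-f'(x)|^2\,dx$ for all $f,f'\in\mathcal H$. 2. $f^*\in\mathcal H^\beta$ for some $\beta\in(1,2)$. 3. With $\hat f_\lambda=f^*-\lambda(\mathcal D^2F^*(f^*)+\lambda\,\mathrm{id})^{-1}f^*$ and $\Theta_{\lambda,3}=\sup_{\phi,\psi,u,v\in\mathcal H}\|(\mathcal D^2F^*(\phi)+\lambda\,\mathrm{id})^{-1}(\mathcal D^3F^*(\psi)uv)\|_{\mathcal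 H}/(\|u\|_{\mathcal H}\|v\|_{\mathcal H})$ (over $u,v\ne0$), both $\|\hat f_\lambda-f^*\|_{\mathcal H}\to0$ and $\Theta_{\lambda,3}\|\hat f_\lambda-f^*\|_{\mathcal H}\to0$ as $\lambda\downarrow0$. 4. The derivatives $\partial_jK(x,\cdot)$ and $\partial^2_{ij}K(x,\cdot)$ in the variable $x$ exist and lie in $\mathcal H$, and for all $x\in\mathcal X$ and all $i,j$: $\|K(x,\cdot)\|_{\mathcal H}\le C_{K,1}$, $\|\partial_jK(x,\cdot)\|_{\mathcal H}\le C_{K,2}$, $\|\partial^2_{ij}K(x,\cdot)\|_{\mathcal H}\le C_{K,3}$. Put $\alpha_\beta=(\beta-1)/(\beta+1)$. Then all functions in $\mathcal H$ are differentiable, and for every $\lambda>0$ the minimizer $f_{n,\lambda}$ exists and is unique. Moreover, for all constants $0<c_1\le c_2$ there is a constant $C$, depending only on $c_1$ and $c_2$, such that the following holds in every such setting, for all sufficiently large $n$. If $$c_1r_n\le\lambda\le c_2r_n,\qquad r_n=C_{K,1}^{1-\alpha_\beta}\,\kappa^{\alpha_\beta}\,\|f^*\|_{\mathcal H^\beta}^{\alpha_\beta-1}\,(\log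 n/n)^{(1-\alpha_\beta)/2},$$ then with probability at least $1-n^{-2}$ both $$\|f_{n,\lambda}-f^*\|_{\mathcal H}\le C\,C_{K,1}^{\alpha_\beta}\,\kappa^{-\alpha_\beta}\,\|f^*\|_{\mathcal H^\beta}^{1-\alpha_\beta}\,(\log n/n)^{\alpha_\beta/2}$$ and $$\int_{\mathcal X}\|\nabla f_{n,\lambda}(x)-\nabla f^*(x)\|_2^2\,d\mathbb P(x)\le C\,C_{K,2}^2\,d\,C_{K,1}^{2\alpha_\beta}\,\kappa^{-2\alpha_\beta}\,\|f^*\|_{\mathcal H^\beta}^{2-2\alpha_\beta}\,(\log n/n)^{\alpha_\beta}.$$ -/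

import Mathlib

open MeasureTheory Filter Topology

/-- The flat `d`-dimensional torus: a box with side lengths `ℓ j` and periodic boundary condition. -/
abbrev Torus {d : ℕ} (ℓ : Fin d → ℝ) : Type := (j : Fin d) → AddCircle (ℓ j)

namespace VarTransport

section Torus

variable {d : ℕ} {ℓ : Fin d → ℝ}

/-- The point `x + t e_j` of the torus. -/
def shift (x : Torus ℓ) (j : Fin d) (t : ℝ) : Torus ℓ :=
  x + Pi.single j (t : AddCircle (ℓ j))

/-- The function `f` on the torus, read in the flat chart `v ↦ x + v` around `x`. -/
def inChart (f : Torus ℓ → ℝ) (x : Torus ℓ) (v : EuclideanSpace ℝ (Fin d)) : ℝ :=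
  f (x + fun j => ((v j : ℝ) : AddCircle (ℓ j)))

/-- The gradient of a function on the torus. -/
noncomputable def torusGrad (f : Torus ℓ → ℝ) (x : Torus ℓ) : EuclideanSpace ℝ (Fin d) :=
  gradient (inChart f x) 0

end Torus

section Kernel

variable {d : ℕ} {ℓ : Fin d → ℝ}
variable (H : Type*) [NormedAddCommGroup H] [InnerProductSpace ℝ H] [CompleteSpace H]
  [RKHS ℝ H (Torus ℓ) ℝ]

/-- The kernel section `K(x, ·)`, as an element of `H`. -/
noncomputable def kerSec (x : Torus ℓ) : H := RKHS.kerFun H x 1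

/-- The kernel is bounded, its partial derivatives `∂_j K(x, ·)` and `∂²_{ij} K(x, ·)` in the first
variable exist and belong to `H`, and they are bounded in the norm of `H`. -/
structure KernelBounds (C₁ C₂ C₃ : ℝ) : Prop where
  norm_le : ∀ x : Torus ℓ, ‖kerSec H x‖ ≤ C₁
  deriv_le : ∃ (K' : Fin d → Torus ℓ → H) (K'' : Fin d → Fin d → Torus ℓ → H),
    (∀ (j : Fin d) (x y : Torus ℓ),
      HasDerivAt (fun t : ℝ => kerSec H (shift x j t) y) (K' j x y) 0) ∧
    (∀ (i j : Fin d) (x y : Torus ℓ),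
      HasDerivAt (fun t : ℝ => K' j (shift x i t) y) (K'' i j x y) 0) ∧
    (∀ (j : Fin d) (x : Torus ℓ), ‖K' j x‖ ≤ C₂) ∧
    (∀ (i j : Fin d) (x : Torus ℓ), ‖K'' i j x‖ ≤ C₃)

variable [∀ j, Fact (0 < ℓ j)]

open Classical in
/-- The embedding `I : H → L²`, with respect to Lebesgue measure, that sends a function to its
almost everywhere class. (It is `0` if this is not a bounded operator into `L²`; it is one
whenever the kernel satisfies `KernelBounds`, see `embed_coeFn`.) -/
noncomputable def embed : H →L[ℝ] Lp ℝ 2 (volume : Measure (Torus ℓ)) :=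
  if h : ∃ I : H →L[ℝ] Lp ℝ 2 (volume : Measure (Torus ℓ)), ∀ f : H, I f =ᵐ[volume] ⇑f
  then h.choose else 0

/-- The integral operator `T = I ∘ I*` on `L²`. -/
noncomputable def intOp :
    Lp ℝ 2 (volume : Measure (Torus ℓ)) →L[ℝ] Lp ℝ 2 (volume : Measure (Torus ℓ)) :=
  embed H ∘L ContinuousLinearMap.adjoint (embed H)

/-- The eigenspace of the integral operator for the number `m`. -/
noncomputable abbrev eigSpace (m : ℝ) : Submodule ℝ (Lp ℝ 2 (volume : Measure (Torus ℓ))) :=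
  (intOp H - m • ContinuousLinearMap.id ℝ (Lp ℝ 2 (volume : Measure (Torus ℓ)))).ker

/-- The vectors of an orthonormal basis of the eigenspace for `m`. -/
noncomputable def eigBasisSet (m : ℝ) : Set (eigSpace H m) :=
  (exists_hilbertBasis ℝ (eigSpace H m)).choose

/-- The index set of the positive eigenvalues, each repeated according to its multiplicity. -/
def EigIndex : Type := Σ m : {m : ℝ // 0 < m}, eigBasisSet H m.1

/-- The positive eigenvalues `μ_i` of the integral operator, with multiplicity. -/
def eigVal (i : EigIndex H) : ℝ := i.1.1

/-- The corresponding `L²`-orthonormal eigenfunctions `ψ_i`. -/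
def eigFun (i : EigIndex H) : Lp ℝ 2 (volume : Measure (Torus ℓ)) := (i.2.1 : eigSpace H i.1.1)

/-- Membership in the power space `H^α`: `f = ∑ u_i μ_i^{α/2} ψ_i` with `∑ u_i² < ∞`. -/
def MemPower (α : ℝ) (f : Lp ℝ 2 (volume : Measure (Torus ℓ))) : Prop :=
  ∃ u : EigIndex H → ℝ, Summable (fun i => u i ^ 2) ∧
    HasSum (fun i => (u i * eigVal H i ^ (α / 2)) • eigFun H i) f

/-- The norm of the power space, `‖f‖_{H^α}² = ∑ μ_i^{-α} ⟨f, ψ_i⟩²`. -/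
noncomputable def powerNorm (α : ℝ) (f : Lp ℝ 2 (volume : Measure (Torus ℓ))) : ℝ :=
  √(∑' i : EigIndex H, eigVal H i ^ (-α) * inner ℝ f (eigFun H i) ^ 2)

end Kernel

section Embedding

variable {d : ℕ} {ℓ : Fin d → ℝ}
variable {H : Type*} [NormedAddCommGroup H] [InnerProductSpace ℝ H] [CompleteSpace H]
  [RKHS ℝ H (Torus ℓ) ℝ]

lemma inner_kerSec (f : H) (x : Torus ℓ) : inner ℝ (kerSec H x) f = f x := by
  simp [kerSec]

lemma KernelBounds.norm_shift_sub_le {C₁ C₂ C₃ : ℝ} (hK : KernelBounds H C₁ C₂ C₃)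
    (x : Torus ℓ) (j : Fin d) (s : ℝ) : ‖kerSec H (shift x j s) - kerSec H x‖ ≤ C₂ * |s| := by
  obtain ⟨K', K'', h1, -, h2, -⟩ := hK.deriv_le
  set w : H := kerSec H (shift x j s) - kerSec H x with hw
  have hsymm : ∀ a b : Torus ℓ, kerSec H a b = kerSec H b a := fun a b => by
    rw [← inner_kerSec, ← inner_kerSec, real_inner_comm]
  have hshift : ∀ t u : ℝ, shift x j (t + u) = shift (shift x j t) j u := fun t u => by
    simp [shift, add_assoc, ← Pi.single_add]
  have hd : ∀ t : ℝ, HasDerivAt (fun t : ℝ => w (shift x j t)) (inner ℝ (K' j (shift x j t)) w) t := by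
    intro t
    have e1 := (h1 j (shift x j t) (shift x j s)).sub (h1 j (shift x j t) x)
    have e2 : HasDerivAt (fun u : ℝ => w (shift x j (t + u)))
        (inner ℝ (K' j (shift x j t)) w) 0 := by
      have e3 : inner ℝ (K' j (shift x j t)) w
          = K' j (shift x j t) (shift x j s) - K' j (shift x j t) x := by
        rw [hw, inner_sub_right, real_inner_comm, inner_kerSec, real_inner_comm, inner_kerSec]
      rw [e3]
      refine e1.congr_of_eventuallyEq (Eventually.of_forall fun u => ?_)
      simp only [hw, RKHS.coe_sub, Pi.sub_apply, hshift]
      rw [hsymm (shift x j s), hsymm x]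
    have e4 : HasDerivAt (fun u : ℝ => w (shift x j (t + u)))
        (inner ℝ (K' j (shift x j t)) w) (t - t) := by simpa using e2
    simpa using HasDerivAt.comp_sub_const t t e4
  have hb := Convex.norm_image_sub_le_of_norm_hasDerivWithin_le (s := Set.univ) (x := (0 : ℝ))
    (y := s) (f := fun t : ℝ => w (shift x j t)) (C := C₂ * ‖w‖)
    (fun t _ => (hd t).hasDerivWithinAt)
    (fun t _ => (norm_inner_le_norm _ _).trans (by gcongr; exact h2 j _))
    convex_univ (Set.mem_univ _) (Set.mem_univ _)
  have h0 : shift x j 0 = x := by simp [shift]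
  have hsq : ‖w‖ * ‖w‖ = w (shift x j s) - w (shift x j 0) := by
    rw [h0, ← real_inner_self_eq_norm_mul_norm, ← inner_kerSec w, ← inner_kerSec w,
      ← inner_sub_left]
  rw [← hsq] at hb
  simp only [norm_mul, sub_zero, Real.norm_eq_abs] at hb
  rcases eq_or_lt_of_le (norm_nonneg w) with h | h
  · rw [← h]
    have : 0 ≤ C₂ := (norm_nonneg _).trans (h2 j x)
    positivity
  · rw [abs_of_pos h] at hb
    nlinarith

lemma KernelBounds.norm_sub_le {C₁ C₂ C₃ : ℝ} (hK : KernelBounds H C₁ C₂ C₃)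
    (x y : Torus ℓ) : ‖kerSec H y - kerSec H x‖ ≤ C₂ * ∑ j, ‖y j - x j‖ := by
  have hrep : ∀ j, ∃ t : ℝ, (t : AddCircle (ℓ j)) = y j - x j ∧ |t| = ‖y j - x j‖ := by
    intro j
    obtain ⟨a, ha⟩ := QuotientAddGroup.mk_surjective (y j - x j)
    refine ⟨a - round ((ℓ j)⁻¹ * a) * ℓ j, ?_, ?_⟩
    · rw [← ha, AddCircle.coe_sub]
      have : (((round ((ℓ j)⁻¹ * a) : ℝ) * ℓ j : ℝ) : AddCircle (ℓ j)) = 0 := by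
        rw [AddCircle.coe_eq_zero_iff]
        exact ⟨round ((ℓ j)⁻¹ * a), by simp⟩
      rw [this, sub_zero]
    · rw [← ha]
      exact (AddCircle.norm_eq (ℓ j)).symm
  choose t ht1 ht2 using hrep
  have key : ∀ s : Finset (Fin d),
      ‖kerSec H (x + ∑ j ∈ s, Pi.single j ((t j : ℝ) : AddCircle (ℓ j))) - kerSec H x‖
        ≤ C₂ * ∑ j ∈ s, |t j| := by
    intro s
    induction s using Finset.induction_on with
    | empty => simp
    | insert a s ha ih =>
      rw [Finset.sum_insert ha, Finset.sum_insert ha, mul_add,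
        add_comm (Pi.single a _), ← add_assoc]
      have h := hK.norm_shift_sub_le (x + ∑ j ∈ s, Pi.single j ((t j : ℝ) : AddCircle (ℓ j))) a (t a)
      rw [shift] at h
      exact (norm_sub_le_norm_sub_add_norm_sub _ _ _).trans (add_le_add h ih)
  have h := key Finset.univ
  rw [Finset.univ_sum_single (fun j => ((t j : ℝ) : AddCircle (ℓ j)))] at h
  have hxy : (x + fun j => ((t j : ℝ) : AddCircle (ℓ j))) = y := by
    funext j
    simp [ht1]
  rw [hxy] at h
  simpa [ht2] using h

lemma KernelBounds.continuous_kerSec {C₁ C₂ C₃ : ℝ} (hK : KernelBounds H C₁ C₂ C₃) :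
    Continuous (kerSec H : Torus ℓ → H) := by
  rw [continuous_iff_continuousAt]
  intro x
  rw [ContinuousAt, tendsto_iff_norm_sub_tendsto_zero]
  refine squeeze_zero (fun _ => norm_nonneg _) (fun y => hK.norm_sub_le x y) ?_
  have hc : Continuous fun y : Torus ℓ => C₂ * ∑ j, ‖y j - x j‖ := by fun_prop
  simpa using hc.tendsto x

lemma KernelBounds.continuous_coe {C₁ C₂ C₃ : ℝ} (hK : KernelBounds H C₁ C₂ C₃) (f : H) :
    Continuous (f : Torus ℓ → ℝ) := by
  have h : (f : Torus ℓ → ℝ) = fun x => inner ℝ (kerSec H x) f := by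
    funext x
    rw [inner_kerSec]
  rw [h]
  exact hK.continuous_kerSec.inner continuous_const

variable [∀ j, Fact (0 < ℓ j)]

/-- Under the kernel bounds, `embed` is the embedding of `H` into `L²`. -/
theorem embed_coeFn {C₁ C₂ C₃ : ℝ} (hK : KernelBounds H C₁ C₂ C₃) (f : H) :
    embed H f =ᵐ[volume] (f : Torus ℓ → ℝ) := by
  have hex : ∃ I : H →L[ℝ] Lp ℝ 2 (volume : Measure (Torus ℓ)), ∀ f : H, I f =ᵐ[volume] ⇑f := by
    let J : H →ₗ[ℝ] C(Torus ℓ, ℝ) :=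
      { toFun := fun f => ⟨f, hK.continuous_coe f⟩
        map_add' := fun f g => by ext x; simp
        map_smul' := fun c f => by ext x; simp }
    let J' : H →L[ℝ] C(Torus ℓ, ℝ) := J.mkContinuous C₁ fun f => by
      have hC : 0 ≤ C₁ := (norm_nonneg _).trans (hK.norm_le 0)
      refine (ContinuousMap.norm_le _ (by positivity)).2 fun x => ?_
      have : (J f) x = inner ℝ (kerSec H x) f := (inner_kerSec f x).symm
      rw [this]
      exact (norm_inner_le_norm _ _).trans (by gcongr; exact hK.norm_le x)
    refine ⟨(ContinuousMap.toLp 2 (volume : Measure (Torus ℓ)) ℝ).comp J', fun f => ?_⟩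
    exact ContinuousMap.coeFn_toLp (𝕜 := ℝ) volume (J' f)
  rw [embed, dif_pos hex]
  exact hex.choose_spec f

end Embedding

section Functional

variable {H : Type*} [NormedAddCommGroup H] [InnerProductSpace ℝ H] [CompleteSpace H]

/-- The second Fréchet derivative `D²F : H → (H → H)` in the norm of `H`. -/
noncomputable def D2 (F : H → ℝ) (f : H) : H →L[ℝ] H := fderiv ℝ (gradient F) f

/-- The third Fréchet derivative, `(u, v) ↦ D³F(f) u v ∈ H`. -/
noncomputable def D3 (F : H → ℝ) (f : H) : H →L[ℝ] H →L[ℝ] H := fderiv ℝ (D2 F) f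

/-- The inverse of `D²F(f) + l · id`. -/
noncomputable def regInv (F : H → ℝ) (l : ℝ) (f : H) : H →L[ℝ] H :=
  ContinuousLinearMap.inverse (D2 F f + l • ContinuousLinearMap.id ℝ H)

/-- The solution `f̂_l = f* - l (D²F(f*) + l · id)⁻¹ f*` of the linearized equation. -/
noncomputable def fHat (F : H → ℝ) (fs : H) (l : ℝ) : H := fs - l • regInv F l fs fs

/-- `Θ_{l,3} = sup ‖(D²F(φ) + l · id)⁻¹ (D³F(ψ) u v)‖ / (‖u‖ ‖v‖)`, with values in `[0, ∞]`. -/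
noncomputable def Theta (F : H → ℝ) (l : ℝ) : ENNReal :=
  ⨆ (φ : H) (ψ : H) (u : H) (v : H),
    ENNReal.ofReal (‖regInv F l φ (D3 F ψ u v)‖ / (‖u‖ * ‖v‖))

/-- `‖f̂_l - f*‖ → 0` and `Θ_{l,3} ‖f̂_l - f*‖ → 0` as `l ↓ 0`. -/
structure LinearizationStable (F : H → ℝ) (fs : H) : Prop where
  bias : Tendsto (fun l : ℝ => ‖fHat F fs l - fs‖) (𝓝[>] 0) (𝓝 0)
  theta : Tendsto (fun l : ℝ => Theta F l * ENNReal.ofReal ‖fHat F fs l - fs‖) (𝓝[>] 0) (𝓝 0)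

variable {d : ℕ} {ℓ : Fin d → ℝ} [RKHS ℝ H (Torus ℓ) ℝ]

/-- `F` is three times Fréchet differentiable on `H`, and strongly convex with modulus `κ` with
respect to the `L²` norm of Lebesgue measure. -/
structure SmoothStronglyConvex [∀ j, Fact (0 < ℓ j)] (F : H → ℝ) (κ : ℝ) : Prop where
  diff₁ : Differentiable ℝ F
  diff₂ : Differentiable ℝ (gradient F)
  diff₃ : Differentiable ℝ (D2 F)
  convex : ∀ f g : H,
    κ / 2 * ∫ x : Torus ℓ, |f x - g x| ^ 2 ≤ F f - F g - inner ℝ (gradient F g) (f - g)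

/-- The population risk `L(f) = - E_P f + F(f)`. -/
noncomputable def popRisk (P : Measure (Torus ℓ)) (F : H → ℝ) (f : H) : ℝ :=
  -(∫ x, f x ∂P) + F f

/-- The regularized empirical risk `- (1/n) ∑ f(X_i) + F(f) + l/2 ‖f‖²`. -/
noncomputable def regEmpRisk {n : ℕ} (F : H → ℝ) (l : ℝ) (X : Fin n → Torus ℓ) (f : H) : ℝ :=
  -(1 / (n : ℝ) * ∑ i, f (X i)) + F f + l / 2 * ‖f‖ ^ 2

end Functional

end VarTransport

/-! Let `b` be the empirical mean of the kernel sections, `b₀` its expectation, and `I` the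
embedding into `L²`. The first-order conditions read `∇F(f) = b - l f` and `∇F(f*) = b₀`. Put `w = f
- f*`. Strong convexity makes `∇F` monotone with modulus `κ` in `L²`, so pairing the difference of
the two equations with `w` gives the energy estimate `κ‖I w‖² + l‖w‖² ≤ ⟨b - b₀, w⟩ - l⟨f*, w⟩`.

Call the left side `l q²`, so that `‖w‖ ≤ q`. The source condition `f* ∈ H^β` gives `|⟨f*, w⟩| ≤ N
(l/κ)^((β-1)/2) q` with `N` the power norm (`KernelBounds.abs_inner_le_powerNorm`). Dividing by `l
q` yields the deterministic bound `‖w‖ ≤ ‖b - b₀‖ / l + N (l/κ)^((β-1)/2)` of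
`SmoothStronglyConvex.norm_sub_le_of_gradient_eq`: stochastic error plus bias.

The deviation `‖b - b₀‖` is of order `C₁ √(log n / n)` with probability at least `1 - n⁻²`, by a
Hoeffding-type inequality in Hilbert space (`measure_norm_sum_ge_le`). The prescribed `l` makes both
terms of the same order (`rate_balance`). The gradient bound follows from the bound in `H`, since
`∂_j f(x) = ⟨∂_j K(x, ·), f⟩`. -/

namespace VarTransport

/-! ### Concentration of sums of independent vectors in a Hilbert space -/

section Concentration

variable {T E : Type*} [MeasurableSpace T] [NormedAddCommGroup E] [InnerProductSpace ℝ E]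
  {P : Measure T} [IsProbabilityMeasure P] {g : T → E} {M : ℝ}

/-- One step of the Gaussian-type exponential moment recursion in a Hilbert space. -/
lemma lintegral_exp_norm_add_sq_le [CompleteSpace E] (hg : StronglyMeasurable g)
    (hM : ∀ x, ‖g x‖ ≤ M) (h0 : ∫ x, g x ∂P = 0) {a : ℝ} (ha : 0 ≤ a) (v : E) :
    ∫⁻ x, ENNReal.ofReal (Real.exp (a * ‖g x + v‖ ^ 2)) ∂P ≤
      ENNReal.ofReal (Real.exp ((a + 2 * a ^ 2 * M ^ 2) * ‖v‖ ^ 2 + a * M ^ 2)) := by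
  have hgi : Integrable g P :=
    Integrable.of_bound hg.aestronglyMeasurable M (Eventually.of_forall hM)
  have hin : ∀ x, |inner ℝ v (g x)| ≤ ‖v‖ * M := fun x =>
    (abs_real_inner_le_norm _ _).trans (by gcongr; exact hM x)
  -- After expanding the square, only the cross term `2a⟨v, g x⟩` is random; it is centred and
  -- bounded, so Hoeffding's lemma applies to it.
  have hsub := ProbabilityTheory.hasSubgaussianMGF_of_mem_Icc_of_integral_eq_zero (μ := P)
    (X := fun x => inner ℝ v (g x)) (a := -(‖v‖ * M)) (b := ‖v‖ * M)
    ((stronglyMeasurable_const.inner hg).measurable.aemeasurable)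
    (Eventually.of_forall fun x => abs_le.1 (hin x))
    (by rw [integral_inner hgi, h0, inner_zero_right])
  have hint := hsub.integrable_exp_mul (2 * a)
  have hmgf := hsub.mgf_le (2 * a)
  have hpt : ∀ x, Real.exp (a * ‖g x + v‖ ^ 2) ≤
      Real.exp (a * (M ^ 2 + ‖v‖ ^ 2)) * Real.exp (2 * a * inner ℝ v (g x)) := by
    intro x
    rw [← Real.exp_add, Real.exp_le_exp, norm_add_sq_real, real_inner_comm]
    have : ‖g x‖ ^ 2 ≤ M ^ 2 := by gcongr; exact hM x
    nlinarith
  have hcst : ((‖(‖v‖ * M) - -(‖v‖ * M)‖₊ / 2 : NNReal) : ℝ) ^ 2 = ‖v‖ ^ 2 * M ^ 2 := by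
    rw [NNReal.coe_div, coe_nnnorm, div_pow, Real.norm_eq_abs, sq_abs]
    push_cast
    ring
  calc ∫⁻ x, ENNReal.ofReal (Real.exp (a * ‖g x + v‖ ^ 2)) ∂P
      ≤ ∫⁻ x, ENNReal.ofReal
          (Real.exp (a * (M ^ 2 + ‖v‖ ^ 2)) * Real.exp (2 * a * inner ℝ v (g x))) ∂P :=
        lintegral_mono fun x => ENNReal.ofReal_le_ofReal (hpt x)
    _ = ENNReal.ofReal (∫ x, Real.exp (a * (M ^ 2 + ‖v‖ ^ 2)) *
          Real.exp (2 * a * inner ℝ v (g x)) ∂P) :=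
        (ofReal_integral_eq_lintegral_ofReal (hint.const_mul _)
          (Eventually.of_forall fun x => by positivity)).symm
    _ ≤ _ := by
        refine ENNReal.ofReal_le_ofReal ?_
        rw [integral_const_mul]
        refine (mul_le_mul_of_nonneg_left hmgf (Real.exp_nonneg _)).trans ?_
        rw [← Real.exp_add, Real.exp_le_exp, NNReal.coe_pow, hcst]
        apply le_of_eq
        ring

/-- Integrating out one coordinate replaces the exponent `a` by `a + 2a²M²`. In the parametrization
`a = 1/(2M²m)` this costs at most the change from `m` to `m - 1`, together with a factor
`exp(1/(2m))`. Since `m` moves, the induction needs all `m > n` at once. -/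
lemma lintegral_exp_norm_sum_sq_le [CompleteSpace E] (hg : StronglyMeasurable g)
    (hM : ∀ x, ‖g x‖ ≤ M) (hM0 : 0 < M) (h0 : ∫ x, g x ∂P = 0) (n : ℕ) :
    ∀ m : ℝ, (n : ℝ) < m →
    ∫⁻ x : Fin n → T, ENNReal.ofReal (Real.exp (1 / (2 * M ^ 2 * m) * ‖∑ i, g (x i)‖ ^ 2))
        ∂(Measure.pi fun _ => P) ≤ ENNReal.ofReal (Real.exp (n / (2 * (m - n)))) := by
  induction n with
  | zero =>
    intro m _
    simp
  | succ n ih =>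
    intro m hm
    push_cast at hm ⊢
    have hn : (0 : ℝ) ≤ n := n.cast_nonneg
    have hm0 : 0 < m := by linarith
    set a : ℝ := 1 / (2 * M ^ 2 * m) with ha
    have ha0 : 0 ≤ a := by positivity
    have hsm : ∀ k : ℕ, StronglyMeasurable fun x : Fin k → T => ∑ i, g (x i) := fun k =>
      Finset.stronglyMeasurable_fun_sum _ fun i _ =>
        hg.comp_measurable (measurable_pi_apply i)
    have hmeas : Measurable fun p : T × (Fin n → T) =>
        ENNReal.ofReal (Real.exp (a * ‖g p.1 + ∑ i, g (p.2 i)‖ ^ 2)) := by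
      have h1 : StronglyMeasurable fun p : T × (Fin n → T) => g p.1 + ∑ i, g (p.2 i) :=
        (hg.comp_measurable measurable_fst).add ((hsm n).comp_measurable measurable_snd)
      exact (((h1.norm.measurable.pow_const 2).const_mul a).exp).ennreal_ofReal
    have hmp := measurePreserving_piFinSuccAbove (fun _ : Fin (n + 1) => P) 0
    -- This reduces to `(m + 1)(m - 1) ≤ m²`.
    have hrec : a + 2 * a ^ 2 * M ^ 2 ≤ 1 / (2 * M ^ 2 * (m - 1)) := by
      have h1 : 0 < m - 1 := by linarith
      have : a + 2 * a ^ 2 * M ^ 2 = (m + 1) / (2 * M ^ 2 * m ^ 2) := by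
        rw [ha]; field_simp
      rw [this, div_le_div_iff₀ (by positivity) (by positivity)]
      have : 0 < M ^ 2 := by positivity
      nlinarith
    have haM : a * M ^ 2 = 1 / (2 * m) := by
      rw [ha]; field_simp
    calc ∫⁻ x : Fin (n + 1) → T, ENNReal.ofReal (Real.exp (a * ‖∑ i, g (x i)‖ ^ 2))
          ∂(Measure.pi fun _ => P)
        = ∫⁻ p : T × (Fin n → T), ENNReal.ofReal
            (Real.exp (a * ‖g p.1 + ∑ i, g (p.2 i)‖ ^ 2))
            ∂(P.prod (Measure.pi fun _ : Fin n => P)) := by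
          rw [← hmp.lintegral_comp hmeas]
          refine lintegral_congr fun x => ?_
          simp [Fin.sum_univ_succ, MeasurableEquiv.piFinSuccAbove, Fin.tail]
      _ = ∫⁻ y : Fin n → T, ∫⁻ z, ENNReal.ofReal
            (Real.exp (a * ‖g z + ∑ i, g (y i)‖ ^ 2)) ∂P ∂(Measure.pi fun _ : Fin n => P) :=
          lintegral_prod_symm' _ hmeas
      _ ≤ ∫⁻ y : Fin n → T, ENNReal.ofReal (Real.exp (1 / (2 * m))) * ENNReal.ofReal
            (Real.exp (1 / (2 * M ^ 2 * (m - 1)) * ‖∑ i, g (y i)‖ ^ 2))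
            ∂(Measure.pi fun _ : Fin n => P) := by
          refine lintegral_mono fun y =>
            (lintegral_exp_norm_add_sq_le hg hM h0 ha0 _).trans ?_
          rw [← ENNReal.ofReal_mul (Real.exp_nonneg _), ← Real.exp_add, haM, add_comm]
          gcongr
      _ ≤ ENNReal.ofReal (Real.exp (1 / (2 * m))) *
            ENNReal.ofReal (Real.exp (n / (2 * (m - 1 - n)))) := by
          rw [lintegral_const_mul']
          · gcongr
            exact ih (m - 1) (by linarith)
          · exact ENNReal.ofReal_ne_top
      _ ≤ ENNReal.ofReal (Real.exp ((n + 1) / (2 * (m - (n + 1))))) := by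
          rw [← ENNReal.ofReal_mul (Real.exp_nonneg _), ← Real.exp_add]
          refine ENNReal.ofReal_le_ofReal (Real.exp_le_exp.2 ?_)
          have h1 : 0 < m - (n + 1) := by linarith
          have h2 : m - 1 - n = m - (n + 1) := by ring
          rw [h2, add_div, add_comm]
          gcongr
          linarith

/-- Tail bound for sums of bounded centred independent vectors in a Hilbert space. -/
theorem measure_norm_sum_ge_le [CompleteSpace E] (hg : StronglyMeasurable g)
    (hM : ∀ x, ‖g x‖ ≤ M) (hM0 : 0 < M) (h0 : ∫ x, g x ∂P = 0) {n : ℕ} (hn : 0 < n)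
    {r : ℝ} (hr : 0 ≤ r) :
    (Measure.pi fun _ : Fin n => P) {x | r ≤ ‖∑ i, g (x i)‖} ≤
      ENNReal.ofReal (Real.exp (1 / 2 - r ^ 2 / (4 * M ^ 2 * n))) := by
  have hn' : (0 : ℝ) < n := by exact_mod_cast hn
  -- The choice `m = 2n` bounds the exponential moment by `exp(1/2)`, whatever `n` is; Markov's
  -- inequality then gives the tail.
  have h := lintegral_exp_norm_sum_sq_le (P := P) hg hM hM0 h0 n (2 * n) (by linarith)
  have hsm : StronglyMeasurable fun x : Fin n → T => ∑ i, g (x i) :=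
    Finset.stronglyMeasurable_fun_sum _ fun i _ => hg.comp_measurable (measurable_pi_apply i)
  set c : ℝ := 1 / (2 * M ^ 2 * (2 * n)) with hc
  have hc0 : 0 ≤ c := by positivity
  have hmk := mul_meas_ge_le_lintegral₀ (μ := Measure.pi fun _ : Fin n => P)
    (f := fun x => ENNReal.ofReal (Real.exp (c * ‖∑ i, g (x i)‖ ^ 2)))
    ((((hsm.norm.measurable.pow_const 2).const_mul c).exp).ennreal_ofReal.aemeasurable)
    (ENNReal.ofReal (Real.exp (c * r ^ 2)))
  have hsubset : {x : Fin n → T | r ≤ ‖∑ i, g (x i)‖} ⊆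
      {x | ENNReal.ofReal (Real.exp (c * r ^ 2)) ≤
        ENNReal.ofReal (Real.exp (c * ‖∑ i, g (x i)‖ ^ 2))} := by
    intro x hx
    simp only [Set.mem_ofPred_eq] at hx ⊢
    gcongr
  have h3 := (mul_le_mul_right (measure_mono hsubset) _).trans (hmk.trans h)
  have h4 : (n : ℝ) / (2 * (2 * n - n)) = 1 / 2 := by field_simp; ring
  have h5 : r ^ 2 / (4 * M ^ 2 * n) = c * r ^ 2 := by rw [hc]; field_simp; ring
  rw [h4] at h3
  rw [h5, Real.exp_sub, ENNReal.ofReal_div_of_pos (Real.exp_pos _),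
    ENNReal.le_div_iff_mul_le (Or.inl (by simp [Real.exp_pos]))
      (Or.inl ENNReal.ofReal_ne_top), mul_comm]
  exact h3

end Concentration

end VarTransport

namespace VarTransport

/-! ### Existence and uniqueness of minimizers -/

section ConvexMinimization

variable {H : Type*} [NormedAddCommGroup H] [InnerProductSpace ℝ H]

/-- A continuous strongly convex function on a Hilbert space has exactly one minimizer. -/
lemma existsUnique_isMinOn_of_strongConvex [CompleteSpace H] {G : H → ℝ} {G' : H → H} {l : ℝ}
    (hl : 0 < l) (hG : Continuous G)
    (hc : ∀ f g, G g + inner ℝ (G' g) (f - g) + l / 2 * ‖f - g‖ ^ 2 ≤ G f) :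
    ∃! f, IsMinOn G Set.univ f := by
  have hmid : ∀ f g, ∃ m, 2 * G m + l / 4 * ‖f - g‖ ^ 2 ≤ G f + G g := by
    intro f g
    set m : H := (1 / 2 : ℝ) • (f + g) with hm
    refine ⟨m, ?_⟩
    have e1 : f - m = (1 / 2 : ℝ) • (f - g) := by rw [hm]; module
    have e2 : g - m = -((1 / 2 : ℝ) • (f - g)) := by rw [hm]; module
    have h1 := hc f m
    have h2 := hc g m
    rw [e1] at h1
    rw [e2, inner_neg_right, norm_neg] at h2
    have e3 : ‖(1 / 2 : ℝ) • (f - g)‖ ^ 2 = 1 / 4 * ‖f - g‖ ^ 2 := by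
      rw [norm_smul, mul_pow]; norm_num
    rw [e3] at h1 h2
    linarith
  -- The tangent at `0` plus the quadratic term is bounded below, by completing the square.
  have hbdd : BddBelow (Set.range G) := by
    refine ⟨G 0 - ‖G' 0‖ ^ 2 / (2 * l), ?_⟩
    rintro _ ⟨f, rfl⟩
    have h1 := hc f 0
    rw [sub_zero] at h1
    have h2 : -(‖G' 0‖ * ‖f‖) ≤ inner ℝ (G' 0) f :=
      (abs_le.1 (abs_real_inner_le_norm _ _)).1
    have h3 : 0 ≤ (‖G' 0‖ - l * ‖f‖) ^ 2 / (2 * l) := by positivity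
    have h4 : (‖G' 0‖ - l * ‖f‖) ^ 2 / (2 * l) =
        ‖G' 0‖ ^ 2 / (2 * l) - ‖G' 0‖ * ‖f‖ + l / 2 * ‖f‖ ^ 2 := by
      field_simp; ring
    linarith
  set v : ℝ := sInf (Set.range G) with hv
  have hvle : ∀ f, v ≤ G f := fun f => csInf_le hbdd ⟨f, rfl⟩
  -- The value at the midpoint is at least the infimum, so near-minimizers are close. This makes
  -- minimizing sequences Cauchy and also gives uniqueness.
  have hdist : ∀ f g, l / 4 * ‖f - g‖ ^ 2 ≤ (G f - v) + (G g - v) := by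
    intro f g
    obtain ⟨m, hm⟩ := hmid f g
    linarith [hvle m]
  have hseq : ∀ n : ℕ, ∃ f, G f < v + 1 / ((n : ℝ) + 1) := by
    intro n
    obtain ⟨_, ⟨f, rfl⟩, hf⟩ := exists_lt_of_csInf_lt (Set.range_nonempty G)
      (lt_add_of_pos_right v (Nat.one_div_pos_of_nat (α := ℝ) (n := n)))
    exact ⟨f, hf⟩
  choose u hu using hseq
  have hcau : CauchySeq u := by
    rw [Metric.cauchySeq_iff']
    intro ε hε
    obtain ⟨N, hN⟩ := exists_nat_one_div_lt (show (0 : ℝ) < l / 8 * ε ^ 2 by positivity)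
    refine ⟨N, fun n hn => ?_⟩
    have h1 := hdist (u n) (u N)
    have h2 : 1 / ((n : ℝ) + 1) ≤ 1 / ((N : ℝ) + 1) := by gcongr
    have h3 : ‖u n - u N‖ ^ 2 < ε ^ 2 := by
      have : l / 4 * ‖u n - u N‖ ^ 2 < l / 4 * ε ^ 2 := by
        linarith [hu n, hu N]
      exact lt_of_mul_lt_mul_left this (by positivity)
    rw [dist_eq_norm]
    exact lt_of_pow_lt_pow_left₀ 2 hε.le h3
  obtain ⟨f, hf⟩ := cauchySeq_tendsto_of_complete hcau
  have hGf : G f ≤ v := by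
    have h1 : Tendsto (fun n => G (u n)) atTop (𝓝 (G f)) := (hG.tendsto f).comp hf
    have h2 : Tendsto (fun n : ℕ => v + 1 / ((n : ℝ) + 1)) atTop (𝓝 (v + 0)) :=
      tendsto_one_div_add_atTop_nhds_zero_nat.const_add v
    rw [add_zero] at h2
    exact le_of_tendsto_of_tendsto' h1 h2 fun n => (hu n).le
  refine ⟨f, fun g _ => hGf.trans (hvle g), fun g hg => ?_⟩
  have h1 : G g ≤ v := le_csInf (Set.range_nonempty G) (by
    rintro _ ⟨k, rfl⟩
    exact hg (Set.mem_univ k))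
  have h2 := hdist g f
  have h3 : ‖g - f‖ ^ 2 ≤ 0 := by
    by_contra! h
    have := mul_pos (show 0 < l / 4 by positivity) h
    linarith
  exact sub_eq_zero.1 (norm_eq_zero.1 (pow_eq_zero_iff two_ne_zero |>.1
    (le_antisymm h3 (by positivity))))

end ConvexMinimization

/-! ### First-order condition -/

section FirstOrder

variable {H : Type*} [NormedAddCommGroup H] [InnerProductSpace ℝ H] [CompleteSpace H]

/-- First-order condition for the minimization of a linear perturbation of `F + l / 2 ‖·‖²`. -/
lemma gradient_eq_of_isMinOn {F : H → ℝ} (hF : Differentiable ℝ F) {b f : H} {l : ℝ}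
    (h : IsMinOn (fun f => -inner ℝ b f + F f + l / 2 * ‖f‖ ^ 2) Set.univ f) :
    gradient F f = b - l • f := by
  have hd : HasFDerivAt (fun f => -inner ℝ b f + F f + l / 2 * ‖f‖ ^ 2)
      (-(innerSL ℝ b) + fderiv ℝ F f + (l / 2) • ((2 : ℕ) • innerSL ℝ f)) f := by
    refine (((innerSL ℝ b).hasFDerivAt.neg).add (hF f).hasFDerivAt).add ?_
    exact (hasStrictFDerivAt_norm_sq f).hasFDerivAt.const_mul (l / 2)
  have h0 := (h.isLocalMin univ_mem).hasFDerivAt_eq_zero hd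
  refine ext_inner_right ℝ fun v => ?_
  have h1 := congrArg (fun L => L v) h0
  have h2 : inner ℝ (gradient F f) v = fderiv ℝ F f v := by
    rw [gradient, InnerProductSpace.toDual_symm_apply]
  simp at h1
  rw [h2, inner_sub_left, real_inner_smul_left]
  linarith

end FirstOrder

end VarTransport

namespace VarTransport

/-! ### From pointwise kernel derivatives to gradients of functions in `H` -/

section KernelDerivative

variable {d : ℕ} {ℓ : Fin d → ℝ}

lemma shift_add (x : Torus ℓ) (j : Fin d) (t u : ℝ) :
    shift x j (t + u) = shift (shift x j t) j u := by
  simp [shift, add_assoc, ← Pi.single_add]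

lemma shift_zero (x : Torus ℓ) (j : Fin d) : shift x j 0 = x := by
  simp [shift]

variable {H : Type*} [NormedAddCommGroup H] [InnerProductSpace ℝ H] [CompleteSpace H]
  [RKHS ℝ H (Torus ℓ) ℝ]

variable (H) in
lemma dense_span_kerSec : Dense (Submodule.span ℝ (Set.range (kerSec H : Torus ℓ → H)) : Set H) := by
  rw [Submodule.dense_iff_topologicalClosure_eq_top, Submodule.topologicalClosure_eq_top_iff,
    Submodule.eq_bot_iff]
  intro f hf
  refine RKHS.ext fun x => ?_
  rw [← inner_kerSec, RKHS.coe_zero, Pi.zero_apply]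
  exact Submodule.inner_right_of_mem_orthogonal (Submodule.subset_span (Set.mem_range_self x)) hf

/-- The kernel derivatives are only given pointwise in the second variable, that is, tested against
kernel sections. These span a dense subspace, so estimates against the span become estimates in
norm. -/
lemma norm_le_of_inner_span_kerSec_le {z : H} {B : ℝ}
    (h : ∀ f ∈ Submodule.span ℝ (Set.range (kerSec H : Torus ℓ → H)),
      |inner ℝ z f| ≤ B * ‖f‖) (hB : 0 ≤ B) : ‖z‖ ≤ B := by
  have hz : |inner ℝ z z| ≤ B * ‖z‖ :=
    (dense_span_kerSec H).induction (P := fun f => |inner ℝ z f| ≤ B * ‖f‖) h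
      (isClosed_le (by fun_prop) (by fun_prop)) z
  rw [real_inner_self_eq_norm_sq, abs_of_nonneg (by positivity)] at hz
  rcases eq_or_lt_of_le (norm_nonneg z) with h0 | h0
  · rwa [← h0]
  · nlinarith

lemma hasDerivAt_inner_of_mem_span {c : ℝ → H} {c' : H} {t : ℝ}
    (h : ∀ y : Torus ℓ, HasDerivAt (fun t => c t y) (c' y) t) {f : H}
    (hf : f ∈ Submodule.span ℝ (Set.range (kerSec H : Torus ℓ → H))) :
    HasDerivAt (fun t => inner ℝ (c t) f) (inner ℝ c' f) t := by
  induction hf using Submodule.span_induction with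
  | mem f hf =>
    obtain ⟨y, rfl⟩ := hf
    have e : ∀ z : H, inner ℝ z (kerSec H y) = z y := fun z => by
      rw [real_inner_comm, inner_kerSec]
    simpa only [e] using h y
  | zero => simpa using hasDerivAt_const t (0 : ℝ)
  | add f g _ _ h1 h2 => simpa only [inner_add_right] using h1.fun_add h2
  | smul a f _ h1 => simpa only [real_inner_smul_right] using h1.const_mul a

omit [CompleteSpace H] in
lemma hasDerivAt_shift {G : Torus ℓ → H} {G' : Torus ℓ → H} {j : Fin d}
    (h : ∀ x y : Torus ℓ, HasDerivAt (fun t : ℝ => G (shift x j t) y) (G' x y) 0)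
    (x y : Torus ℓ) (t : ℝ) :
    HasDerivAt (fun t : ℝ => G (shift x j t) y) (G' (shift x j t) y) t := by
  have e : HasDerivAt (fun u : ℝ => G (shift x j (t + u)) y) (G' (shift x j t) y) (t - t) := by
    simpa only [shift_add, sub_self] using h (shift x j t) y
  simpa using HasDerivAt.comp_sub_const t t e

/-- The mean value inequality holds for each scalar function `t ↦ ⟨G(x + t e_j), f⟩` with `f` in the
span, with constant `B‖f‖`; density removes `f`. -/
lemma norm_shift_sub_le_of_hasDerivAt {G G' : Torus ℓ → H} {j : Fin d} {B : ℝ}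
    (h : ∀ x y : Torus ℓ, HasDerivAt (fun t : ℝ => G (shift x j t) y) (G' x y) 0)
    (hB : ∀ x, ‖G' x‖ ≤ B) (x : Torus ℓ) (s : ℝ) : ‖G (shift x j s) - G x‖ ≤ B * |s| := by
  have hB0 : 0 ≤ B := (norm_nonneg _).trans (hB x)
  refine norm_le_of_inner_span_kerSec_le (fun f hf => ?_) (by positivity)
  have hb := Convex.norm_image_sub_le_of_norm_hasDerivWithin_le (s := Set.univ) (x := (0 : ℝ))
    (y := s) (f := fun t : ℝ => inner ℝ (G (shift x j t)) f) (C := B * ‖f‖)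
    (fun t _ => (hasDerivAt_inner_of_mem_span (fun y => hasDerivAt_shift h x y t)
      hf).hasDerivWithinAt)
    (fun t _ => (norm_inner_le_norm _ _).trans (by gcongr; exact hB _))
    convex_univ (Set.mem_univ _) (Set.mem_univ _)
  simp only [shift_zero, sub_zero, Real.norm_eq_abs, ← inner_sub_left] at hb
  linarith

/-- A Lipschitz derivative turns the weak derivative into a norm expansion with quadratic remainder.
-/
lemma norm_shift_sub_sub_smul_le {G G' : Torus ℓ → H} {j : Fin d} {B : ℝ}
    (h : ∀ x y : Torus ℓ, HasDerivAt (fun t : ℝ => G (shift x j t) y) (G' x y) 0) (hB0 : 0 ≤ B)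
    (hB : ∀ x s, ‖G' (shift x j s) - G' x‖ ≤ B * |s|) (x : Torus ℓ) (s : ℝ) :
    ‖G (shift x j s) - G x - s • G' x‖ ≤ B * |s| ^ 2 := by
  refine norm_le_of_inner_span_kerSec_le (fun f hf => ?_) (by positivity)
  -- The segment is needed here: the derivative is only bounded by `B|t|‖f‖`, which requires `|t| ≤
  -- |s|`.
  have hb := Convex.norm_image_sub_le_of_norm_hasDerivWithin_le (s := Set.uIcc 0 s)
    (x := (0 : ℝ)) (y := s)
    (f := fun t : ℝ => inner ℝ (G (shift x j t)) f - t * inner ℝ (G' x) f) (C := B * |s| * ‖f‖)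
    (f' := fun t => inner ℝ (G' (shift x j t) - G' x) f)
    (fun t _ => by
      have h1 := (hasDerivAt_inner_of_mem_span (fun y => hasDerivAt_shift h x y t) hf).sub
        ((hasDerivAt_id t).mul_const (inner ℝ (G' x) f))
      rw [one_mul, ← inner_sub_left] at h1
      exact h1.hasDerivWithinAt)
    (fun t ht => (norm_inner_le_norm _ _).trans (by
      have : |t| ≤ |s| := by simpa using Set.abs_sub_left_of_mem_uIcc ht
      gcongr
      exact (hB _ _).trans (by gcongr)))
    (convex_uIcc _ _) Set.left_mem_uIcc Set.right_mem_uIcc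
  simp only [shift_zero, sub_zero, Real.norm_eq_abs, zero_mul] at hb
  rw [inner_sub_left, inner_sub_left, real_inner_smul_left]
  calc _ = |inner ℝ (G (shift x j s)) f - s * inner ℝ (G' x) f - inner ℝ (G x) f| := by
        congr 1; ring
    _ ≤ _ := hb
    _ = _ := by ring

omit [InnerProductSpace ℝ H] [CompleteSpace H] [RKHS ℝ H (Torus ℓ) ℝ] in
lemma norm_add_sum_single_sub_le {G : Torus ℓ → H} {B : ℝ}
    (hB : ∀ j x s, ‖G (shift x j s) - G x‖ ≤ B * |s|) (x : Torus ℓ) (v : Fin d → ℝ)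
    (s : Finset (Fin d)) :
    ‖G (x + ∑ j ∈ s, Pi.single j ((v j : ℝ) : AddCircle (ℓ j))) - G x‖ ≤ B * ∑ j ∈ s, |v j| := by
  induction s using Finset.induction_on with
  | empty => simp
  | insert a s ha ih =>
    rw [Finset.sum_insert ha, Finset.sum_insert ha, mul_add, add_comm (Pi.single a _), ← add_assoc]
    exact (norm_sub_le_norm_sub_add_norm_sub _ _ _).trans (add_le_add (hB a _ (v a)) ih)

omit [InnerProductSpace ℝ H] [CompleteSpace H] [RKHS ℝ H (Torus ℓ) ℝ] in
lemma continuous_of_norm_shift_sub_le {G : Torus ℓ → H} {B : ℝ}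
    (hB : ∀ j x s, ‖G (shift x j s) - G x‖ ≤ B * |s|) : Continuous G := by
  have hrep : ∀ (j : Fin d) (a : AddCircle (ℓ j)), ∃ t : ℝ, (t : AddCircle (ℓ j)) = a ∧ |t| = ‖a‖ := by
    intro j a
    -- The real representative closest to `0` has absolute value equal to the quotient norm.
    obtain ⟨a, rfl⟩ := QuotientAddGroup.mk_surjective a
    refine ⟨a - round ((ℓ j)⁻¹ * a) * ℓ j, ?_, (AddCircle.norm_eq (ℓ j)).symm⟩
    rw [AddCircle.coe_sub, sub_eq_self, AddCircle.coe_eq_zero_iff]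
    exact ⟨round ((ℓ j)⁻¹ * a), by simp⟩
  choose t ht1 ht2 using hrep
  rw [continuous_iff_continuousAt]
  intro x
  rw [ContinuousAt, tendsto_iff_norm_sub_tendsto_zero]
  refine squeeze_zero (g := fun y => B * ∑ j, ‖y j - x j‖) (fun _ => norm_nonneg _) (fun y => ?_) ?_
  · have h := norm_add_sum_single_sub_le hB x (fun j => t j (y j - x j)) Finset.univ
    rw [Finset.univ_sum_single (fun j => ((t j (y j - x j) : ℝ) : AddCircle (ℓ j)))] at h
    have hxy : (x + fun j => ((t j (y j - x j) : ℝ) : AddCircle (ℓ j))) = y := by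
      funext j
      simp [ht1]
    rw [hxy] at h
    simpa [ht2] using h
  · have hc : Continuous fun y : Torus ℓ => B * ∑ j, ‖y j - x j‖ := by fun_prop
    simpa using hc.tendsto x

lemma norm_add_sum_single_sub_sub_le {G : Torus ℓ → H} {G' : Fin d → Torus ℓ → H} {B : ℝ}
    (h : ∀ j x y, HasDerivAt (fun t : ℝ => G (shift x j t) y) (G' j x y) 0) (hB0 : 0 ≤ B)
    (hB : ∀ i j x s, ‖G' j (shift x i s) - G' j x‖ ≤ B * |s|) (x : Torus ℓ) (v : Fin d → ℝ)
    (s : Finset (Fin d)) :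
    ‖G (x + ∑ j ∈ s, Pi.single j ((v j : ℝ) : AddCircle (ℓ j))) - G x - ∑ j ∈ s, v j • G' j x‖
      ≤ B * (∑ j ∈ s, |v j|) ^ 2 := by
  induction s using Finset.induction_on with
  | empty => simp
  | insert a s ha ih =>
    rw [Finset.sum_insert ha, Finset.sum_insert ha, Finset.sum_insert ha,
      add_comm (Pi.single a _), ← add_assoc]
    set y : Torus ℓ := x + ∑ j ∈ s, Pi.single j ((v j : ℝ) : AddCircle (ℓ j)) with hy
    have h1 := norm_shift_sub_sub_smul_le (h a) hB0 (fun x s => hB a a x s) y (v a)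
    have h2 := norm_add_sum_single_sub_le (G := G' a) (fun i x s => hB i a x s) x v s
    rw [← hy] at h2
    -- Besides the remainder of the new step, the derivative has to be moved from `y` back to `x`;
    -- its Lipschitz bound yields the cross term of the squared sum.
    have h3 : G (y + Pi.single a ((v a : ℝ) : AddCircle (ℓ a))) - G x
        - (v a • G' a x + ∑ j ∈ s, v j • G' j x) =
        (G (shift y a (v a)) - G y - v a • G' a y) + v a • (G' a y - G' a x)
          + (G y - G x - ∑ j ∈ s, v j • G' j x) := by
      rw [shift]; module
    have h4 : ‖v a • (G' a y - G' a x)‖ ≤ |v a| * (B * ∑ j ∈ s, |v j|) := by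
      rw [norm_smul, Real.norm_eq_abs]; gcongr
    have h5 : 0 ≤ |v a| * (B * ∑ j ∈ s, |v j|) := by positivity
    rw [h3]
    refine (norm_add₃_le).trans ?_
    nlinarith

/-- The functions of the space have the gradient given by the derivatives of the kernel. -/
lemma hasGradientAt_inChart {G' : Fin d → Torus ℓ → H} {B : ℝ}
    (h : ∀ (j : Fin d) (x y : Torus ℓ),
      HasDerivAt (fun t : ℝ => kerSec H (shift x j t) y) (G' j x y) 0) (hB0 : 0 ≤ B)
    (hB : ∀ i j x s, ‖G' j (shift x i s) - G' j x‖ ≤ B * |s|) (f : H) (x : Torus ℓ) :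
    HasGradientAt (inChart f x) (WithLp.toLp 2 fun j => inner ℝ (G' j x) f) 0 := by
  rw [hasGradientAt_iff_isLittleO_nhds_zero]
  have hO : (fun v : EuclideanSpace ℝ (Fin d) => inChart f x (0 + v) - inChart f x 0 -
      inner ℝ (WithLp.toLp 2 fun j => inner ℝ (G' j x) f : EuclideanSpace ℝ (Fin d)) v)
      =O[𝓝 0] fun v => ‖v‖ ^ 2 := by
    refine Asymptotics.IsBigO.of_bound (B * d ^ 2 * ‖f‖) (Eventually.of_forall fun v => ?_)
    have h1 := norm_add_sum_single_sub_sub_le h hB0 hB x v Finset.univ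
    rw [Finset.univ_sum_single (fun j => ((v j : ℝ) : AddCircle (ℓ j)))] at h1
    have h2 : inChart f x (0 + v) - inChart f x 0 -
        inner ℝ (WithLp.toLp 2 fun j => inner ℝ (G' j x) f : EuclideanSpace ℝ (Fin d)) v =
        inner ℝ (kerSec H (x + fun j => ((v j : ℝ) : AddCircle (ℓ j))) - kerSec H x
          - ∑ j, v j • G' j x) f := by
      have hz : (x + fun j => (((0 : EuclideanSpace ℝ (Fin d)) j : ℝ) : AddCircle (ℓ j))) = x := by
        funext j; simp
      rw [inner_sub_left, inner_sub_left, inner_kerSec, inner_kerSec, sum_inner, inChart, inChart,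
        hz, zero_add, PiLp.inner_apply]
      congr 1
      refine Finset.sum_congr rfl fun j _ => ?_
      simp [real_inner_smul_left]
    have h3 : ∑ j, |v j| ≤ d * ‖v‖ := by
      calc ∑ j, |v j| ≤ ∑ _j : Fin d, ‖v‖ := Finset.sum_le_sum fun j _ => PiLp.norm_apply_le v j
        _ = d * ‖v‖ := by simp
    rw [h2, Real.norm_of_nonneg (by positivity : (0 : ℝ) ≤ ‖v‖ ^ 2)]
    calc _ ≤ _ := norm_inner_le_norm _ _
      _ ≤ B * (∑ j, |v j|) ^ 2 * ‖f‖ := by gcongr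
      _ ≤ B * (d * ‖v‖) ^ 2 * ‖f‖ := by gcongr
      _ = _ := by ring
  refine hO.trans_isLittleO ?_
  simpa using Asymptotics.isLittleO_norm_pow_id (E' := EuclideanSpace ℝ (Fin d)) one_lt_two

lemma KernelBounds.exists_gradient {C₁ C₂ C₃ : ℝ} (hK : KernelBounds H C₁ C₂ C₃) :
    ∃ K' : Fin d → Torus ℓ → H, (∀ j x, ‖K' j x‖ ≤ C₂) ∧ (∀ j, Continuous (K' j)) ∧
      ∀ (f : H) (x : Torus ℓ),
        HasGradientAt (inChart f x) (WithLp.toLp 2 fun j => inner ℝ (K' j x) f) 0 := by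
  obtain ⟨K', K'', h1, h2, h3, h4⟩ := hK.deriv_le
  -- The absolute value covers `d = 0`, where the bounds do not force `C₃ ≥ 0`.
  have hL : ∀ i j x s, ‖K' j (shift x i s) - K' j x‖ ≤ |C₃| * |s| := fun i j x s =>
    norm_shift_sub_le_of_hasDerivAt (fun x y => h2 i j x y)
      (fun x => (h4 i j x).trans (le_abs_self _)) x s
  exact ⟨K', h3, fun j => continuous_of_norm_shift_sub_le fun i x s => hL i j x s,
    fun f x => hasGradientAt_inChart h1 (abs_nonneg _) hL f x⟩

lemma KernelBounds.differentiableAt_inChart {C₁ C₂ C₃ : ℝ} (hK : KernelBounds H C₁ C₂ C₃)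
    (f : H) (x : Torus ℓ) : DifferentiableAt ℝ (inChart f x) 0 := by
  obtain ⟨K', -, -, h⟩ := hK.exists_gradient
  exact (h f x).differentiableAt

/-- The gradient error is controlled by the error in the norm of the space. -/
lemma KernelBounds.integral_norm_torusGrad_sub_sq_le [∀ j, Fact (0 < ℓ j)] {C₁ C₂ C₃ : ℝ}
    (hK : KernelBounds H C₁ C₂ C₃) (P : Measure (Torus ℓ)) [IsProbabilityMeasure P] (f g : H) :
    Integrable (fun x => ‖torusGrad f x - torusGrad g x‖ ^ 2) P ∧
      ∫ x, ‖torusGrad f x - torusGrad g x‖ ^ 2 ∂P ≤ C₂ ^ 2 * d * ‖f - g‖ ^ 2 := by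
  obtain ⟨K', hb, hc, h⟩ := hK.exists_gradient
  have e : ∀ x, ‖torusGrad f x - torusGrad g x‖ ^ 2 = ∑ j, inner ℝ (K' j x) (f - g) ^ 2 := by
    intro x
    rw [torusGrad, torusGrad, (h f x).gradient, (h g x).gradient, EuclideanSpace.norm_sq_eq]
    refine Finset.sum_congr rfl fun j _ => ?_
    simp [inner_sub_right]
  simp_rw [e]
  have hle : ∀ x, ∑ j, inner ℝ (K' j x) (f - g) ^ 2 ≤ C₂ ^ 2 * d * ‖f - g‖ ^ 2 := by
    intro x
    calc ∑ j, inner ℝ (K' j x) (f - g) ^ 2 ≤ ∑ _j : Fin d, C₂ ^ 2 * ‖f - g‖ ^ 2 := by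
          refine Finset.sum_le_sum fun j _ => ?_
          rw [← sq_abs, ← mul_pow]
          gcongr
          exact (abs_real_inner_le_norm _ _).trans (by gcongr; exact hb j x)
      _ = _ := by simp; ring
  have hcont : Continuous fun x => ∑ j, inner ℝ (K' j x) (f - g) ^ 2 :=
    continuous_finsetSum _ fun j _ => ((hc j).inner continuous_const).pow 2
  have hint : Integrable (fun x => ∑ j, inner ℝ (K' j x) (f - g) ^ 2) P :=
    Integrable.of_bound hcont.aestronglyMeasurable (C₂ ^ 2 * d * ‖f - g‖ ^ 2)
      (Eventually.of_forall fun x => by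
        rw [Real.norm_of_nonneg (Finset.sum_nonneg fun j _ => sq_nonneg _)]
        exact hle x)
  refine ⟨hint, ?_⟩
  simpa using integral_mono hint (integrable_const (C₂ ^ 2 * d * ‖f - g‖ ^ 2)) hle

end KernelDerivative

end VarTransport

namespace VarTransport

/-! ### Spectral form of the source condition -/

section Source

variable {d : ℕ} {ℓ : Fin d → ℝ} [∀ j, Fact (0 < ℓ j)]
variable {H : Type*} [NormedAddCommGroup H] [InnerProductSpace ℝ H] [CompleteSpace H]
  [RKHS ℝ H (Torus ℓ) ℝ]

/-- Functions in `H` are continuous and Lebesgue measure charges every nonempty open set. -/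
lemma KernelBounds.embed_injective {C₁ C₂ C₃ : ℝ} (hK : KernelBounds H C₁ C₂ C₃) :
    Function.Injective (embed H) := by
  intro f g h
  have h1 : (f : Torus ℓ → ℝ) =ᵐ[volume] g :=
    (embed_coeFn hK f).symm.trans (h ▸ embed_coeFn hK g)
  have h2 := ((hK.continuous_coe f).ae_eq_iff_eq volume (hK.continuous_coe g)).1 h1
  exact DFunLike.coe_injective h2

lemma KernelBounds.norm_embed_sq {C₁ C₂ C₃ : ℝ} (hK : KernelBounds H C₁ C₂ C₃) (f : H) :
    ‖embed H f‖ ^ 2 = ∫ x : Torus ℓ, |f x| ^ 2 := by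
  rw [← real_inner_self_eq_norm_sq, L2.inner_def]
  refine integral_congr_ae ?_
  filter_upwards [embed_coeFn hK f] with x hx
  rw [hx, real_inner_self_eq_norm_sq, Real.norm_eq_abs]

lemma intOp_eigFun (i : EigIndex H) : intOp H (eigFun H i) = eigVal H i • eigFun H i := by
  have h : eigFun H i ∈ eigSpace H (eigVal H i) := i.2.1.2
  rw [LinearMap.mem_ker] at h
  simpa [sub_eq_zero] using h

lemma eigVal_pos (i : EigIndex H) : 0 < eigVal H i := i.1.2

lemma inner_intOp_left (g h : Lp ℝ 2 (volume : Measure (Torus ℓ))) :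
    inner ℝ (intOp H g) h =
      inner ℝ (ContinuousLinearMap.adjoint (embed H) g) (ContinuousLinearMap.adjoint (embed H) h) := by
  rw [intOp, ContinuousLinearMap.comp_apply, ← ContinuousLinearMap.adjoint_inner_right]

variable (H) in
lemma orthonormal_eigFun : Orthonormal ℝ (eigFun H) := by
  have hB : ∀ m, Orthonormal ℝ ((↑) : eigBasisSet H m → eigSpace H m) := fun m => by
    obtain ⟨B, hB⟩ := (exists_hilbertBasis ℝ (eigSpace H m)).choose_spec
    have h := B.orthonormal
    rwa [hB] at h
  refine ⟨fun i => (hB i.1.1).1 i.2, ?_⟩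
  intro i j hij
  by_cases h : eigVal H i = eigVal H j
  · obtain ⟨⟨m, hm⟩, a⟩ := i
    obtain ⟨⟨m', hm'⟩, b⟩ := j
    obtain rfl : m = m' := h
    exact (hB m).2 fun hab => hij (by
      obtain rfl : a = b := hab
      rfl)
  · have h1 : eigVal H i * inner ℝ (eigFun H i) (eigFun H j) =
        eigVal H j * inner ℝ (eigFun H i) (eigFun H j) := by
      rw [← real_inner_smul_left, ← intOp_eigFun, inner_intOp_left, ← real_inner_smul_right,
        ← intOp_eigFun, real_inner_comm (intOp H _), inner_intOp_left, real_inner_comm]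
    by_contra h3
    exact h (mul_right_cancel₀ h3 h1)

variable (H) in
/-- The `H`-normalized eigenfunctions `μ_i^{-1/2} I* ψ_i`. -/
noncomputable def hEigFun (i : EigIndex H) : H :=
  (√(eigVal H i))⁻¹ • ContinuousLinearMap.adjoint (embed H) (eigFun H i)

lemma inner_hEigFun (i : EigIndex H) (w : H) :
    inner ℝ (hEigFun H i) w = (√(eigVal H i))⁻¹ * inner ℝ (eigFun H i) (embed H w) := by
  rw [hEigFun, real_inner_smul_left, ContinuousLinearMap.adjoint_inner_left]

variable (H) in
-- This holds because `⟨I*ψ_i, I*ψ_j⟩ = ⟨ψ_i, T ψ_j⟩ = μ_j δ_ij`.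
lemma orthonormal_hEigFun : Orthonormal ℝ (hEigFun H) := by
  classical
  rw [orthonormal_iff_ite]
  intro i j
  have h := (orthonormal_iff_ite.1 (orthonormal_eigFun H)) i j
  have e : embed H (ContinuousLinearMap.adjoint (embed H) (eigFun H j)) =
      eigVal H j • eigFun H j := intOp_eigFun j
  rw [inner_hEigFun, hEigFun, map_smul, e, real_inner_smul_right, real_inner_smul_right, h]
  split_ifs with hij
  · subst hij
    have := eigVal_pos i
    have h2 := Real.mul_self_sqrt this.le
    have h3 : √(eigVal H i) ≠ 0 := (Real.sqrt_pos.2 this).ne'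
    field_simp
    linarith
  · simp

/-- Every function of the power space has coefficients with the power norm. -/
lemma MemPower.exists_hasSum {β : ℝ} {f : Lp ℝ 2 (volume : Measure (Torus ℓ))}
    (h : MemPower H β f) :
    ∃ u : EigIndex H → ℝ, HasSum (fun i => u i ^ 2) (powerNorm H β f ^ 2) ∧
      HasSum (fun i => (u i * eigVal H i ^ (β / 2)) • eigFun H i) f := by
  obtain ⟨u, hu, hf⟩ := h
  refine ⟨u, ?_, hf⟩
  have hcoef : ∀ i, inner ℝ f (eigFun H i) = u i * eigVal H i ^ (β / 2) := by
    intro i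
    classical
    have h1 := hf.mapL (innerSL ℝ (eigFun H i))
    have h2 : ∀ j, innerSL ℝ (eigFun H i) ((u j * eigVal H j ^ (β / 2)) • eigFun H j) =
        if j = i then u i * eigVal H i ^ (β / 2) else 0 := by
      intro j
      rw [innerSL_apply_apply, real_inner_smul_right,
        (orthonormal_iff_ite.1 (orthonormal_eigFun H)) i j]
      by_cases hij : j = i
      · subst hij; simp
      · simp [hij, Ne.symm hij]
    simp_rw [h2] at h1
    rw [real_inner_comm]
    exact h1.unique (hasSum_ite_eq i _)
  have hterm : ∀ i, eigVal H i ^ (-β) * inner ℝ f (eigFun H i) ^ 2 = u i ^ 2 := by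
    intro i
    have hp := eigVal_pos i
    rw [hcoef, mul_pow, ← Real.rpow_natCast (eigVal H i ^ (β / 2)), ← Real.rpow_mul hp.le]
    have : β / 2 * ((2 : ℕ) : ℝ) = β := by push_cast; ring
    rw [this, mul_left_comm, ← Real.rpow_add hp]
    simp
  rw [powerNorm, Real.sq_sqrt (tsum_nonneg fun i => by
    have := eigVal_pos i
    positivity)]
  simp_rw [hterm]
  exact hu.hasSum

/-- The interpolation inequality behind the bias bound. -/
lemma KernelBounds.abs_inner_le_powerNorm {C₁ C₂ C₃ : ℝ} (hK : KernelBounds H C₁ C₂ C₃)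
    {β : ℝ} (hβ1 : 1 < β) (hβ2 : β < 2) {f : H} (hf : MemPower H β (embed H f))
    {κ l : ℝ} (hκ : 0 < κ) (hl : 0 < l) (w : H) :
    |inner ℝ f w| ≤ powerNorm H β (embed H f) * (l / κ) ^ ((β - 1) / 2) *
      √((κ * ‖embed H w‖ ^ 2 + l * ‖w‖ ^ 2) / l) := by
  obtain ⟨u, hu, hs⟩ := hf.exists_hasSum
  have hN : 0 ≤ powerNorm H β (embed H f) := Real.sqrt_nonneg _
  -- It suffices to treat `w = I*h`, for which `⟨f, w⟩ = ⟨I f, h⟩` can be read off the `L²`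
  -- expansion of `I f`. Only Bessel's inequality is then needed, not completeness of the
  -- eigenfunctions.
  have hdense : Dense (Set.range (ContinuousLinearMap.adjoint (embed H))) := by
    have : Dense ((ContinuousLinearMap.adjoint (embed H)).range : Set H) := by
      rw [Submodule.dense_iff_topologicalClosure_eq_top, Submodule.topologicalClosure_eq_top_iff,
        ContinuousLinearMap.orthogonal_range, ContinuousLinearMap.adjoint_adjoint]
      exact LinearMap.ker_eq_bot.2 hK.embed_injective
    rwa [LinearMap.coe_range] at this
  refine hdense.induction (P := fun w => |inner ℝ f w| ≤ powerNorm H β (embed H f) *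
    (l / κ) ^ ((β - 1) / 2) * √((κ * ‖embed H w‖ ^ 2 + l * ‖w‖ ^ 2) / l)) ?_
    (isClosed_le (by fun_prop) (by fun_prop)) w
  rintro _ ⟨h, rfl⟩
  set w : H := ContinuousLinearMap.adjoint (embed H) h with hw
  have hsum := hs.mapL (innerSL ℝ h)
  have hterm : ∀ i, innerSL ℝ h ((u i * eigVal H i ^ (β / 2)) • eigFun H i) =
      u i * (eigVal H i ^ ((β - 1) / 2) * inner ℝ (hEigFun H i) w) := by
    intro i
    have hp := eigVal_pos i
    have e : embed H w = intOp H h := rfl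
    have e2 : inner ℝ (eigFun H i) (intOp H h) = eigVal H i * inner ℝ h (eigFun H i) := by
      rw [real_inner_comm, inner_intOp_left, real_inner_comm, ← inner_intOp_left, intOp_eigFun,
        real_inner_smul_left, real_inner_comm]
    rw [innerSL_apply_apply, real_inner_smul_right, inner_hEigFun, e, e2]
    have e3 : eigVal H i ^ (β / 2) = eigVal H i ^ ((β - 1) / 2) * √(eigVal H i) := by
      rw [Real.sqrt_eq_rpow, ← Real.rpow_add hp]; congr 1; ring
    have e4 : √(eigVal H i) ≠ 0 := (Real.sqrt_pos.2 hp).ne'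
    have e5 : (√(eigVal H i))⁻¹ * eigVal H i = √(eigVal H i) := by
      rw [inv_mul_eq_div, Real.div_sqrt]
    rw [e3, ← mul_assoc (√(eigVal H i))⁻¹, e5]
    ring
  simp_rw [hterm] at hsum
  rw [innerSL_apply_apply, real_inner_comm, ← ContinuousLinearMap.adjoint_inner_right] at hsum
  refine le_of_tendsto ((continuous_abs.tendsto _).comp hsum) (Eventually.of_forall fun A => ?_)
  have hA1 : ∑ i ∈ A, u i ^ 2 ≤ powerNorm H β (embed H f) ^ 2 :=
    sum_le_hasSum A (fun i _ => sq_nonneg _) hu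
  have hA2 : ∑ i ∈ A, inner ℝ (hEigFun H i) w ^ 2 ≤ ‖w‖ ^ 2 := by
    simpa using (orthonormal_hEigFun H).sum_inner_products_le w (s := A)
  have hA3 : ∑ i ∈ A, eigVal H i * inner ℝ (hEigFun H i) w ^ 2 ≤ ‖embed H w‖ ^ 2 := by
    have h1 : ∑ i ∈ A, inner ℝ (eigFun H i) (embed H w) ^ 2 ≤ ‖embed H w‖ ^ 2 := by
      simpa using (orthonormal_eigFun H).sum_inner_products_le (embed H w) (s := A)
    refine le_trans (le_of_eq (Finset.sum_congr rfl fun i _ => ?_)) h1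
    have hp := eigVal_pos i
    rw [inner_hEigFun, mul_pow, inv_pow, Real.sq_sqrt hp.le, ← mul_assoc,
      mul_inv_cancel₀ hp.ne', one_mul]
  set τ : ℝ := (l / κ) ^ ((β - 1) / 2) with hτ
  have hlκ : 0 < l / κ := by positivity
  have hτ0 : 0 < τ := Real.rpow_pos_of_pos hlκ _
  -- With `x = κμ_i/l` this is `x^(β-1) ≤ x + 1`, valid because `0 ≤ β - 1 ≤ 1`.
  have hpow : ∀ i, (eigVal H i ^ ((β - 1) / 2)) ^ 2 ≤ τ ^ 2 * (κ * eigVal H i / l + 1) := by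
    intro i
    have hp := eigVal_pos i
    have hx : 0 < κ * eigVal H i / l := by positivity
    have e1 : eigVal H i = l / κ * (κ * eigVal H i / l) := by field_simp
    have e2 : (eigVal H i ^ ((β - 1) / 2)) = τ * (κ * eigVal H i / l) ^ ((β - 1) / 2) := by
      conv_lhs => rw [e1]
      rw [Real.mul_rpow hlκ.le hx.le]
    rw [e2, mul_pow]
    gcongr
    rw [← Real.rpow_natCast, ← Real.rpow_mul hx.le]
    have e3 : (β - 1) / 2 * ((2 : ℕ) : ℝ) = β - 1 := by push_cast; ring
    rw [e3]
    rcases le_total 1 (κ * eigVal H i / l) with h1 | h1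
    · have := Real.rpow_le_rpow_of_exponent_le h1 (show β - 1 ≤ 1 by linarith)
      rw [Real.rpow_one] at this
      linarith
    · have := Real.rpow_le_one hx.le h1 (show 0 ≤ β - 1 by linarith)
      linarith
  have hA4 : ∑ i ∈ A, (eigVal H i ^ ((β - 1) / 2) * inner ℝ (hEigFun H i) w) ^ 2 ≤
      τ ^ 2 * ((κ * ‖embed H w‖ ^ 2 + l * ‖w‖ ^ 2) / l) := by
    calc _ ≤ ∑ i ∈ A, (τ ^ 2 * (κ / l) * (eigVal H i * inner ℝ (hEigFun H i) w ^ 2) +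
          τ ^ 2 * inner ℝ (hEigFun H i) w ^ 2) := by
          refine Finset.sum_le_sum fun i _ => ?_
          rw [mul_pow]
          refine (mul_le_mul_of_nonneg_right (hpow i) (sq_nonneg _)).trans (le_of_eq ?_)
          ring
      _ = τ ^ 2 * (κ / l) * ∑ i ∈ A, eigVal H i * inner ℝ (hEigFun H i) w ^ 2 +
          τ ^ 2 * ∑ i ∈ A, inner ℝ (hEigFun H i) w ^ 2 := by
          rw [Finset.sum_add_distrib, Finset.mul_sum, Finset.mul_sum]
      _ ≤ τ ^ 2 * (κ / l) * ‖embed H w‖ ^ 2 + τ ^ 2 * ‖w‖ ^ 2 := by gcongr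
      _ = _ := by field_simp
  have hcs := Finset.sum_mul_sq_le_sq_mul_sq A u
    (fun i => eigVal H i ^ ((β - 1) / 2) * inner ℝ (hEigFun H i) w)
  have hQ : 0 ≤ (κ * ‖embed H w‖ ^ 2 + l * ‖w‖ ^ 2) / l := by positivity
  refine abs_le_of_sq_le_sq ?_ (by positivity)
  calc _ ≤ _ := hcs
    _ ≤ powerNorm H β (embed H f) ^ 2 * (τ ^ 2 * ((κ * ‖embed H w‖ ^ 2 + l * ‖w‖ ^ 2) / l)) := by
      gcongr
    _ = _ := by rw [mul_pow, mul_pow, Real.sq_sqrt hQ]; ring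

/-- Positivity matters because the scale of `l` contains the negative power `N^(α-1)`. -/
lemma KernelBounds.powerNorm_pos {C₁ C₂ C₃ : ℝ} (hK : KernelBounds H C₁ C₂ C₃)
    {β : ℝ} {f : H} (hf : MemPower H β (embed H f)) (h0 : f ≠ 0) :
    0 < powerNorm H β (embed H f) := by
  refine lt_of_le_of_ne (Real.sqrt_nonneg _) fun hN => h0 (hK.embed_injective ?_)
  obtain ⟨u, hu, hs⟩ := hf.exists_hasSum
  rw [← hN, zero_pow two_ne_zero, hasSum_zero_iff_of_nonneg fun i => sq_nonneg _] at hu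
  have hu0 : ∀ i, u i = 0 := fun i => by simpa using congrFun hu i
  simp only [hu0, zero_mul, zero_smul] at hs
  rw [map_zero]
  exact hs.unique hasSum_zero

end Source

end VarTransport

namespace VarTransport

/-! ### Deterministic error bound and deviation of the empirical mean -/

section Estimator

variable {d : ℕ} {ℓ : Fin d → ℝ} [∀ j, Fact (0 < ℓ j)]
variable {H : Type*} [NormedAddCommGroup H] [InnerProductSpace ℝ H] [CompleteSpace H]
  [RKHS ℝ H (Torus ℓ) ℝ]

lemma SmoothStronglyConvex.monotone_gradient {F : H → ℝ} {κ : ℝ} (hF : SmoothStronglyConvex F κ)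
    (f g : H) :
    κ * ∫ x : Torus ℓ, |f x - g x| ^ 2 ≤ inner ℝ (gradient F f - gradient F g) (f - g) := by
  have h1 := hF.convex f g
  have h2 := hF.convex g f
  have e : ∫ x : Torus ℓ, |g x - f x| ^ 2 = ∫ x : Torus ℓ, |f x - g x| ^ 2 := by
    simp_rw [abs_sub_comm]
  rw [e, ← neg_sub f g, inner_neg_right] at h2
  rw [inner_sub_left]
  linarith

/-- The mean of the kernel sections at the sample points. -/
noncomputable def empMean (H : Type*) [NormedAddCommGroup H] [InnerProductSpace ℝ H]
    [CompleteSpace H] [RKHS ℝ H (Torus ℓ) ℝ] {n : ℕ} (x : Fin n → Torus ℓ) : H :=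
  (1 / (n : ℝ)) • ∑ i, kerSec H (x i)

omit [∀ j, Fact (0 < ℓ j)] in
lemma regEmpRisk_eq {n : ℕ} (F : H → ℝ) (l : ℝ) (x : Fin n → Torus ℓ) :
    regEmpRisk F l x = fun f => -inner ℝ (empMean H x) f + F f + l / 2 * ‖f‖ ^ 2 := by
  funext f
  simp only [regEmpRisk, empMean, real_inner_smul_left, sum_inner, inner_kerSec]

lemma SmoothStronglyConvex.existsUnique_isMinOn_regEmpRisk {F : H → ℝ} {κ : ℝ} (hκ : 0 < κ)
    (hF : SmoothStronglyConvex F κ) {n : ℕ} {l : ℝ} (hl : 0 < l) (x : Fin n → Torus ℓ) :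
    ∃! f : H, IsMinOn (regEmpRisk F l x) Set.univ f := by
  rw [regEmpRisk_eq]
  refine existsUnique_isMinOn_of_strongConvex
    (G' := fun g => gradient F g - empMean H x + l • g) hl ?_ fun f g => ?_
  · have := hF.diff₁.continuous
    fun_prop
  · have h1 := hF.convex f g
    have h2 : 0 ≤ κ / 2 * ∫ x : Torus ℓ, |f x - g x| ^ 2 :=
      mul_nonneg (by positivity) (integral_nonneg fun x => by positivity)
    have h3 : ‖f‖ ^ 2 = ‖g‖ ^ 2 + 2 * inner ℝ g (f - g) + ‖f - g‖ ^ 2 := by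
      rw [← norm_add_sq_real, add_sub_cancel]
    have h4 : inner ℝ (empMean H x) f =
        inner ℝ (empMean H x) g + inner ℝ (empMean H x) (f - g) := by
      rw [← inner_add_right, add_sub_cancel]
    rw [inner_add_left, inner_sub_left, real_inner_smul_left, h3, h4]
    linarith

/-- Deterministic error bound for the solution of the regularized equation. -/
lemma SmoothStronglyConvex.norm_sub_le_of_gradient_eq {F : H → ℝ} {κ C₁ C₂ C₃ β l : ℝ}
    (hκ : 0 < κ) (hF : SmoothStronglyConvex F κ) (hK : KernelBounds H C₁ C₂ C₃)
    (hβ1 : 1 < β) (hβ2 : β < 2) (hl : 0 < l) {f fs b b₀ : H} (hfs : MemPower H β (embed H fs))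
    (h0 : gradient F fs = b₀) (h : gradient F f = b - l • f) :
    ‖f - fs‖ ≤ ‖b - b₀‖ / l + powerNorm H β (embed H fs) * (l / κ) ^ ((β - 1) / 2) := by
  set w : H := f - fs with hw
  have h1 := hF.monotone_gradient f fs
  have h2 : ∫ x : Torus ℓ, |f x - fs x| ^ 2 = ‖embed H w‖ ^ 2 := by
    rw [hK.norm_embed_sq, hw]
    simp
  have h3 : gradient F f - gradient F fs = (b - b₀) - l • fs - l • w := by
    rw [h0, h, hw]; module
  rw [h2, h3, ← hw, inner_sub_left, inner_sub_left, real_inner_smul_left, real_inner_smul_left,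
    real_inner_self_eq_norm_sq] at h1
  have h4 := hK.abs_inner_le_powerNorm hβ1 hβ2 hfs hκ hl w
  set N : ℝ := powerNorm H β (embed H fs) with hN
  set τ : ℝ := (l / κ) ^ ((β - 1) / 2) with hτ
  -- Estimating in this energy norm, not in `‖w‖` alone, lets the `L²` convexity absorb part of the
  -- bias term.
  set q : ℝ := √((κ * ‖embed H w‖ ^ 2 + l * ‖w‖ ^ 2) / l) with hq
  have hq0 : 0 ≤ q := Real.sqrt_nonneg _
  have hq2 : l * q ^ 2 = κ * ‖embed H w‖ ^ 2 + l * ‖w‖ ^ 2 := by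
    rw [hq, Real.sq_sqrt (by positivity)]; field_simp
  have hwq : ‖w‖ ≤ q := by
    refine Real.le_sqrt_of_sq_le ?_
    rw [le_div_iff₀ hl]
    nlinarith [mul_nonneg hκ.le (sq_nonneg ‖embed H w‖)]
  have h5 : inner ℝ (b - b₀) w ≤ ‖b - b₀‖ * q :=
    (real_inner_le_norm _ _).trans (by gcongr)
  have h6 : l * q ^ 2 ≤ (‖b - b₀‖ + l * (N * τ)) * q := by
    have := mul_le_mul_of_nonneg_left ((neg_le_abs _).trans h4) hl.le
    nlinarith
  refine hwq.trans ?_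
  rcases eq_or_lt_of_le hq0 with h7 | h7
  · rw [← h7]
    have : 0 ≤ N := Real.sqrt_nonneg _
    positivity
  · have h8 : l * q ≤ ‖b - b₀‖ + l * (N * τ) := by
      refine le_of_mul_le_mul_right ?_ h7
      nlinarith
    calc q = l * q / l := by field_simp
      _ ≤ (‖b - b₀‖ + l * (N * τ)) / l := by gcongr
      _ = _ := by field_simp

omit [∀ j, Fact (0 < ℓ j)] in
lemma KernelBounds.integrable_kerSec {C₁ C₂ C₃ : ℝ} (hK : KernelBounds H C₁ C₂ C₃)
    (P : Measure (Torus ℓ)) [IsProbabilityMeasure P] : Integrable (kerSec H) P :=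
  Integrable.of_bound hK.continuous_kerSec.stronglyMeasurable.aestronglyMeasurable C₁
    (Eventually.of_forall hK.norm_le)

lemma KernelBounds.gradient_eq_of_isMinOn_popRisk {C₁ C₂ C₃ κ : ℝ} (hK : KernelBounds H C₁ C₂ C₃)
    {P : Measure (Torus ℓ)} [IsProbabilityMeasure P] {F : H → ℝ} (hF : SmoothStronglyConvex F κ)
    {fs : H} (h : IsMinOn (popRisk P F) Set.univ fs) :
    gradient F fs = ∫ x, kerSec H x ∂P := by
  -- The population risk is the case `l = 0` of the functional in `gradient_eq_of_isMinOn`.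
  have e : popRisk P F = fun f => -inner ℝ (∫ x, kerSec H x ∂P) f + F f + 0 / 2 * ‖f‖ ^ 2 := by
    funext f
    have h1 : inner ℝ (∫ x, kerSec H x ∂P) f = ∫ x, f x ∂P := by
      rw [real_inner_comm, ← integral_inner (hK.integrable_kerSec P)]
      simp_rw [real_inner_comm _ f, inner_kerSec]
    rw [popRisk, h1]
    ring
  rw [e] at h
  simpa using gradient_eq_of_isMinOn hF.diff₁ h

omit [∀ j, Fact (0 < ℓ j)] in
/-- With high probability the empirical mean of the kernel sections is close to its mean. -/
lemma KernelBounds.exists_event_norm_empMean_sub_lt {C₁ C₂ C₃ : ℝ}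
    (hK : KernelBounds H C₁ C₂ C₃) (hC₁ : 0 < C₁) (P : Measure (Torus ℓ)) [IsProbabilityMeasure P]
    {n : ℕ} (hn : 3 ≤ n) {Ω : Type*} [MeasurableSpace Ω] {μ : Measure Ω} [IsProbabilityMeasure μ]
    {X : Fin n → Ω → Torus ℓ} (hX : ∀ i, Measurable (X i)) (hind : ProbabilityTheory.iIndepFun X μ)
    (hP : ∀ i, μ.map (X i) = P) :
    ∃ E : Set Ω, MeasurableSet E ∧ 1 - ((n : ℝ) ^ 2)⁻¹ ≤ μ.real E ∧
      ∀ ω ∈ E, ‖empMean H (fun i => X i ω) - ∫ x, kerSec H x ∂P‖ ≤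
        7 * (C₁ * √(Real.log n / n)) := by
  have hn0 : (0 : ℝ) < n := by exact_mod_cast (by omega : 0 < n)
  have hn3 : (3 : ℝ) ≤ n := by exact_mod_cast hn
  have hlog : 1 ≤ Real.log n := by
    rw [Real.le_log_iff_exp_le hn0]
    linarith [Real.exp_one_lt_d9]
  set b₀ : H := ∫ x, kerSec H x ∂P with hb₀
  set g : Torus ℓ → H := fun x => kerSec H x - b₀ with hg
  have hgm : StronglyMeasurable g :=
    hK.continuous_kerSec.stronglyMeasurable.sub stronglyMeasurable_const
  have hb₀n : ‖b₀‖ ≤ C₁ := by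
    simpa using norm_integral_le_of_norm_le_const (μ := P) (Eventually.of_forall hK.norm_le)
  have hgb : ∀ x, ‖g x‖ ≤ 2 * C₁ := fun x =>
    (_root_.norm_sub_le _ _).trans (by linarith [hK.norm_le x])
  have hg0 : ∫ x, g x ∂P = 0 := by
    rw [hg, integral_sub (hK.integrable_kerSec P) (integrable_const _)]
    simp [hb₀]
  -- With the bound `2C₁` on the centred sections, the factor `7` gives the tail exponent `1/2 -
  -- (49/16) log n`. It is at most `-2 log n` since `log n ≥ 1`, which is where `n ≥ 3` enters.
  set r : ℝ := n * (7 * (C₁ * √(Real.log n / n))) with hr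
  have hr0 : 0 ≤ r := by positivity
  set S : Set (Fin n → Torus ℓ) := {x | r ≤ ‖∑ i, g (x i)‖} with hS
  have hsm : StronglyMeasurable fun x : Fin n → Torus ℓ => ∑ i, g (x i) :=
    Finset.stronglyMeasurable_fun_sum _ fun i _ => hgm.comp_measurable (measurable_pi_apply i)
  have hSm : MeasurableSet S := measurableSet_le measurable_const hsm.norm.measurable
  have hXm : Measurable fun ω i => X i ω := measurable_pi_lambda _ hX
  have htail := measure_norm_sum_ge_le (P := P) hgm hgb (by positivity) hg0
    (by omega : 0 < n) hr0
  have hmap : μ.map (fun ω i => X i ω) = Measure.pi fun _ => P := by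
    rw [(ProbabilityTheory.iIndepFun_iff_map_fun_eq_pi_map fun i => (hX i).aemeasurable).1 hind]
    simp_rw [hP]
  have hpre : μ ((fun ω i => X i ω) ⁻¹' S) ≤ ENNReal.ofReal ((n : ℝ) ^ 2)⁻¹ := by
    rw [← Measure.map_apply hXm hSm, hmap]
    refine htail.trans (ENNReal.ofReal_le_ofReal ?_)
    have h1 : r ^ 2 / (4 * (2 * C₁) ^ 2 * n) = 49 / 16 * Real.log n := by
      rw [hr, mul_pow, mul_pow, mul_pow, Real.sq_sqrt (by positivity)]
      field_simp
      ring
    have h2 : ((n : ℝ) ^ 2)⁻¹ = Real.exp (-(2 * Real.log n)) := by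
      rw [Real.exp_neg, two_mul, Real.exp_add, Real.exp_log hn0, sq]
    rw [h1, h2]
    exact Real.exp_le_exp.2 (by linarith)
  refine ⟨((fun ω i => X i ω) ⁻¹' S)ᶜ, (hXm hSm).compl, ?_, fun ω hω => ?_⟩
  · rw [probReal_compl_eq_one_sub (hXm hSm)]
    have := ENNReal.toReal_le_of_le_ofReal (by positivity) hpre
    rw [Measure.real]
    linarith
  · have h1 : ‖∑ i, g (X i ω)‖ < r := not_le.1 hω
    have h2 : empMean H (fun i => X i ω) - b₀ = (1 / (n : ℝ)) • ∑ i, g (X i ω) := by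
      rw [empMean, hg, Finset.sum_sub_distrib, smul_sub, Finset.sum_const, Finset.card_univ,
        Fintype.card_fin, ← Nat.cast_smul_eq_nsmul ℝ, smul_smul, one_div_mul_cancel hn0.ne',
        one_smul]
    rw [h2, norm_smul, Real.norm_of_nonneg (by positivity), one_div, inv_mul_le_iff₀ hn0]
    exact h1.le

omit [∀ j, Fact (0 < ℓ j)] in
lemma KernelBounds.const_pos {C₁ C₂ C₃ : ℝ} (hK : KernelBounds H C₁ C₂ C₃) {f : H} (hf : f ≠ 0) :
    0 < C₁ := by
  by_contra! hC
  refine hf (RKHS.ext fun x => ?_)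
  have h : kerSec H x = 0 := norm_le_zero_iff.1 ((hK.norm_le x).trans hC)
  rw [← inner_kerSec, h, inner_zero_left, RKHS.coe_zero, Pi.zero_apply]

end Estimator

/-! ### Balancing the two error terms -/

section Rates

/-- The regularization scale balances the stochastic error and the bias. -/
lemma rate_balance {A κ N L α β : ℝ} (hA : 0 < A) (hκ : 0 < κ) (hN : 0 < N) (hL : 0 < L)
    (hβ : 1 < β) (hα : α = (β - 1) / (β + 1)) :
    A * √L = A ^ (1 - α) * κ ^ α * N ^ (α - 1) * L ^ ((1 - α) / 2) *
        (A ^ α * κ ^ (-α) * N ^ (1 - α) * L ^ (α / 2)) ∧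
      N * (A ^ (1 - α) * κ ^ α * N ^ (α - 1) * L ^ ((1 - α) / 2) / κ) ^ ((β - 1) / 2) =
        A ^ α * κ ^ (-α) * N ^ (1 - α) * L ^ (α / 2) ∧
      (A ^ α * κ ^ (-α) * N ^ (1 - α) * L ^ (α / 2)) ^ 2 =
        A ^ (2 * α) * κ ^ (-(2 * α)) * N ^ (2 - 2 * α) * L ^ α := by
  obtain ⟨a, rfl⟩ : ∃ a, Real.exp a = A := ⟨_, Real.exp_log hA⟩
  obtain ⟨k, rfl⟩ : ∃ a, Real.exp a = κ := ⟨_, Real.exp_log hκ⟩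
  obtain ⟨v, rfl⟩ : ∃ a, Real.exp a = N := ⟨_, Real.exp_log hN⟩
  obtain ⟨t, rfl⟩ : ∃ a, Real.exp a = L := ⟨_, Real.exp_log hL⟩
  have h : (β - 1) / 2 * (1 - α) = α := by
    have : β + 1 ≠ 0 := by linarith
    rw [hα]; field_simp; ring
  -- In logarithmic variables the identities compare exponents; the second one uses `(β-1)/2 · (1-α)
  -- = α`.
  simp only [← Real.exp_half, ← Real.exp_mul, ← Real.exp_add, ← Real.exp_sub, ← Real.exp_nat_mul]
  refine ⟨congrArg _ (by ring), congrArg _ ?_, congrArg _ (by push_cast; ring)⟩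
  linear_combination (a - k - v + t / 2) * h

end Rates

end VarTransport
-- Assembly of the main theorem
open VarTransport in
theorem theorem4 (c₁ c₂ : ℝ) (hc₁ : 0 < c₁) (hc₂ : c₁ ≤ c₂) :
    ∃ C : ℝ, 0 < C ∧
    ∀ (d : ℕ) (ℓ : Fin d → ℝ) [∀ j, Fact (0 < ℓ j)]
      (H : Type*) [NormedAddCommGroup H] [InnerProductSpace ℝ H] [CompleteSpace H]
      [RKHS ℝ H (Torus ℓ) ℝ]
      (P : Measure (Torus ℓ)) [IsProbabilityMeasure P]
      (F : H → ℝ) (fs : H) (κ β α C₁ C₂ C₃ : ℝ),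
      0 < κ → SmoothStronglyConvex F κ →
      IsMinOn (popRisk P F) Set.univ fs → fs ≠ 0 →
      1 < β → β < 2 → MemPower H β (embed H fs) →
      LinearizationStable F fs →
      KernelBounds H C₁ C₂ C₃ →
      α = (β - 1) / (β + 1) →
      -- the estimator is well defined, and the functions in `H` are differentiable
      (∀ (n : ℕ) (l : ℝ), 0 < l → ∀ x : Fin n → Torus ℓ,
        ∃! f : H, IsMinOn (regEmpRisk F l x) Set.univ f) ∧
      (∀ (f : H) (x : Torus ℓ), DifferentiableAt ℝ (inChart f x) 0) ∧
      -- the statistical error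
      ∃ n₀ : ℕ, ∀ n : ℕ, n₀ ≤ n → ∀ l : ℝ,
        c₁ * (C₁ ^ (1 - α) * κ ^ α * powerNorm H β (embed H fs) ^ (α - 1) *
          (Real.log n / n) ^ ((1 - α) / 2)) ≤ l →
        l ≤ c₂ * (C₁ ^ (1 - α) * κ ^ α * powerNorm H β (embed H fs) ^ (α - 1) *
          (Real.log n / n) ^ ((1 - α) / 2)) →
        ∀ (Ω : Type*) [MeasurableSpace Ω] (μ : Measure Ω) [IsProbabilityMeasure μ]
          (X : Fin n → Ω → Torus ℓ), (∀ i, Measurable (X i)) →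
          ProbabilityTheory.iIndepFun X μ → (∀ i, μ.map (X i) = P) →
          ∃ E : Set Ω, MeasurableSet E ∧ 1 - ((n : ℝ) ^ 2)⁻¹ ≤ μ.real E ∧
            ∀ ω ∈ E, ∀ f : H, IsMinOn (regEmpRisk F l (fun i => X i ω)) Set.univ f →
              ‖f - fs‖ ≤ C * (C₁ ^ α * κ ^ (-α) * powerNorm H β (embed H fs) ^ (1 - α) *
                (Real.log n / n) ^ (α / 2)) ∧
              Integrable (fun x => ‖torusGrad f x - torusGrad fs x‖ ^ 2) P ∧
              ∫ x, ‖torusGrad f x - torusGrad fs x‖ ^ 2 ∂P ≤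
                C * (C₂ ^ 2 * d * C₁ ^ (2 * α) * κ ^ (-(2 * α)) *
                  powerNorm H β (embed H fs) ^ (2 - 2 * α) * (Real.log n / n) ^ α) := by
  have hc₂0 : 0 < c₂ := hc₁.trans_le hc₂
  -- The error in `H` has constant `7/c₁ + 1 + c₂`. The gradient bound needs its square, which also
  -- serves for the first bound because the base is at least `1`.
  refine ⟨(7 / c₁ + 1 + c₂) ^ 2, by positivity, ?_⟩
  intro d ℓ _ H _ _ _ _ P _ F fs κ β α C₁ C₂ C₃ hκ hF hmin hfs0 hβ1 hβ2 hfs _ hK hα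
  refine ⟨fun n l hl x => hF.existsUnique_isMinOn_regEmpRisk hκ hl x,
    hK.differentiableAt_inChart, 3, ?_⟩
  intro n hn l hl1 hl2 Ω _ μ _ X hX hind hP
  have hC₁ : 0 < C₁ := hK.const_pos hfs0
  have hN := hK.powerNorm_pos hfs hfs0
  have hn0 : (0 : ℝ) < n := by exact_mod_cast (by omega : 0 < n)
  have hL : 0 < Real.log n / n := div_pos (Real.log_pos (by exact_mod_cast (by omega : 1 < n))) hn0
  obtain ⟨E, hEm, hE, hdev⟩ := hK.exists_event_norm_empMean_sub_lt hC₁ P hn hX hind hP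
  refine ⟨E, hEm, hE, fun ω hω f hf => ?_⟩
  obtain ⟨hb1, hb2, hb3⟩ := rate_balance hC₁ hκ hN hL hβ1 hα
  set N := powerNorm H β (embed H fs)
  set L := Real.log n / n
  set r := C₁ ^ (1 - α) * κ ^ α * N ^ (α - 1) * L ^ ((1 - α) / 2)
  set ρ := C₁ ^ α * κ ^ (-α) * N ^ (1 - α) * L ^ (α / 2)
  have hr : 0 < r := by positivity
  have hρ : 0 < ρ := by positivity
  have hl : 0 < l := (mul_pos hc₁ hr).trans_le hl1
  rw [regEmpRisk_eq] at hf
  have hdet := hF.norm_sub_le_of_gradient_eq hκ hK hβ1 hβ2 hl hfs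
    (hK.gradient_eq_of_isMinOn_popRisk hF hmin) (gradient_eq_of_isMinOn hF.diff₁ hf)
  have hstoch : ‖empMean H (fun i => X i ω) - ∫ x, kerSec H x ∂P‖ / l ≤ 7 / c₁ * ρ := by
    rw [div_le_iff₀ hl]
    calc _ ≤ 7 * (C₁ * √L) := hdev ω hω
      _ = 7 / c₁ * ρ * (c₁ * r) := by rw [hb1]; field_simp
      _ ≤ 7 / c₁ * ρ * l := by gcongr
  -- The factor `c₂^((β-1)/2)` is replaced by `1 + c₂` so that the constant does not depend on `β`.
  have hbias : N * (l / κ) ^ ((β - 1) / 2) ≤ (1 + c₂) * ρ := by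
    have hs : 0 < (β - 1) / 2 := by linarith
    calc N * (l / κ) ^ ((β - 1) / 2) ≤ N * (c₂ * (r / κ)) ^ ((β - 1) / 2) := by
          rw [← mul_div_assoc]; gcongr
      _ = c₂ ^ ((β - 1) / 2) * ρ := by
          rw [Real.mul_rpow hc₂0.le (by positivity), ← hb2]; ring
      _ ≤ (1 + c₂) * ρ := by
          gcongr
          calc c₂ ^ ((β - 1) / 2) ≤ (1 + c₂) ^ ((β - 1) / 2) := by gcongr; linarith
            _ ≤ (1 + c₂) ^ (1 : ℝ) :=
                Real.rpow_le_rpow_of_exponent_le (by linarith) (by linarith)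
            _ = 1 + c₂ := Real.rpow_one _
  have herr : ‖f - fs‖ ≤ (7 / c₁ + 1 + c₂) * ρ := by
    linarith
  obtain ⟨hint, hle⟩ := hK.integral_norm_torusGrad_sub_sq_le P f fs
  refine ⟨herr.trans ?_, hint, hle.trans ?_⟩
  · gcongr
    have : 1 ≤ 7 / c₁ + 1 + c₂ := by
      have : 0 < 7 / c₁ := by positivity
      linarith
    nlinarith
  · calc C₂ ^ 2 * d * ‖f - fs‖ ^ 2 ≤ C₂ ^ 2 * d * ((7 / c₁ + 1 + c₂) * ρ) ^ 2 := by gcongr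
      _ = (7 / c₁ + 1 + c₂) ^ 2 * (C₂ ^ 2 * d * ρ ^ 2) := by ring
      _ = _ := by rw [hb3]; ring
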